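/- Graphs have oriented edges with a source, a target and a fixed-point-free reversal $r$; loops and multiple edges are allowed. Let $K_\infty=\mathbb{F}_2((t^{-1}))$ with ring of integers $\mathcal{O}=\mathbb{F}_2[[t^{-1}]]$, and let $\mathfrak{t}$ be the Bruhat–Tits tree of $K_\infty$: its vertices are the maximal $\mathcal{O}$-orders in $\mathbb{M}_2(K_\infty)$, and $\mathfrak{D},\mathfrak{D}'$ are joined by an edge when in some basis $\mathfrak{D}=\begin{pmatrix}\mathcal{O}&\mathcal{O}\\ \mathcal{O}&\mathcal{O}\end{pmatrix}$ and $\mathfrak{D}'=\begin{pmatrix}\mathcal{O}&t^{-1}\mathcal{O}\\ t\mathcal{O}&\mathcal{O}\end{pmatrix}$. The group $\mathrm{GL}_2(\mathbb{F}_2[t])$ acts on $\mathfrak{t}$ by conjugation, without inversions. For $f\in\mathbb{F}_2[t]$ let $\Gamma(f)\subseteq\mathrm{GL}_2(\mathbb{F}_2[t])$ be the subgroup of matrices congruent to the identity modulo $f$, and for $n\ge 0$ say that a vertex of $\Gamma(f)\backslash\mathfrak{t}$ is of type $n$ if it is the image of an order in the $\mathrm{GL}_2(\mathbb{F}_2[t])$-orbit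 of $\mathrm{End}_{\mathcal{O}}\left\langle\binom{0}{1},\binom{t^{n}}{0}\right\rangle$. Let $\mathfrak{a}$ be the largest subgraph of $\Gamma(f)\backslash\mathfrak{t}$ having only type-$0$ and type-$1$ vertices, and let $\mathfrak{o}$ be the graph whose vertices are the type-$0$ vertices of $\mathfrak{a}$ and whose edges are the paths $(e_1,e_2)$ of two edges in $\mathfrak{a}$ with $e_2\neq r(e_1)$ that lead from a type-$0$ vertex through a vertex that is not of type $0$ to a type-$0$ vertex, the reverse of $(e_1,e_2)$ being $(r(e_2),r(e_1))$. **Theorem.** Let $f\in\mathbb{F}_2[t]$ be a quadratic polynomial. Then $\mathfrak{a}$ is isomorphic to the barycentric subdivision of $\mathfrak{o}$, by an isomorphism under which the type-$0$ vertices of $\mathfrak{a}$ correspond to the vertices of $\mathfrak{o}$ (and the type-$1$ vertices to the midpoints of edges). Moreover: 1. if $f=t(t+1)$, then $\mathfrak{o}$ is isomorphic to the complete bipartite graph $K_{3,3}$; 2. if $f$ is a perfect square, then $\mathfrak{o}$ is isomorphic to the 1-skeleton of a cube; 3. if $f=t^2+t+1$, then $\mathfrak{o}$ is isomorphic to the Petersen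 graph. -/

import Mathlib

/-! ### Graphs with oriented edges -/

/-- A graph: a set of vertices, a set of (oriented) edges, source, target, and a fixed-point-free
reversal of edges. Loops and multiple edges are allowed. -/
structure SerreGraph where
  /-- vertices -/
  V : Type
  /-- oriented edges -/
  A : Type
  /-- source -/
  s : A → V
  /-- target -/
  t : A → V
  /-- reverse edge -/
  r : A → A
  r_r : ∀ a, r (r a) = a
  r_ne : ∀ a, r a ≠ a
  s_r : ∀ a, s (r a) = t a

namespace SerreGraph

theorem t_r (𝔤 : SerreGraph) (a : 𝔤.A) : 𝔤.t (𝔤.r a) = 𝔤.s a := by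
  rw [← 𝔤.s_r, 𝔤.r_r]

/-- Isomorphisms of graphs. -/
structure Iso (𝔤 𝔥 : SerreGraph) where
  onV : 𝔤.V ≃ 𝔥.V
  onA : 𝔤.A ≃ 𝔥.A
  map_s : ∀ a, 𝔥.s (onA a) = onV (𝔤.s a)
  map_t : ∀ a, 𝔥.t (onA a) = onV (𝔤.t a)
  map_r : ∀ a, 𝔥.r (onA a) = onA (𝔤.r a)

/-- A simple graph, seen as a graph with oriented edges. -/
def ofSimpleGraph {W : Type} (G : SimpleGraph W) : SerreGraph where
  V := W
  A := G.Dart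
  s a := a.fst
  t a := a.snd
  r a := a.symm
  r_r a := a.symm_symm
  r_ne a := a.symm_ne
  s_r _ := rfl

/-- The largest subgraph all of whose vertices satisfy `P`. -/
def induce (𝔤 : SerreGraph) (P : 𝔤.V → Prop) : SerreGraph where
  V := {v : 𝔤.V // P v}
  A := {a : 𝔤.A // P (𝔤.s a) ∧ P (𝔤.t a)}
  s a := ⟨𝔤.s a.1, a.2.1⟩
  t a := ⟨𝔤.t a.1, a.2.2⟩
  r a := ⟨𝔤.r a.1, by rw [𝔤.s_r, 𝔤.t_r]; exact ⟨a.2.2, a.2.1⟩⟩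
  r_r a := Subtype.ext (𝔤.r_r a.1)
  r_ne a h := 𝔤.r_ne a.1 (congrArg Subtype.val h)
  s_r a := Subtype.ext (𝔤.s_r a.1)

/-- Compatibility of actions of `G` on vertices and edges: `G` acts by graph automorphisms. -/
class ActsOn (G : Type) [Group G] (𝔤 : SerreGraph) [MulAction G 𝔤.V] [MulAction G 𝔤.A] :
    Prop where
  smul_s : ∀ (g : G) (a : 𝔤.A), 𝔤.s (g • a) = g • 𝔤.s a
  smul_t : ∀ (g : G) (a : 𝔤.A), 𝔤.t (g • a) = g • 𝔤.t a
  smul_r : ∀ (g : G) (a : 𝔤.A), 𝔤.r (g • a) = g • 𝔤.r a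

/-- The quotient graph by a group acting without inversions: vertices and edges are the orbits of
vertices and edges. -/
def quotient (𝔤 : SerreGraph) (G : Type) [Group G] [MulAction G 𝔤.V] [MulAction G 𝔤.A]
    [hG : ActsOn G 𝔤] (noInv : ∀ (g : G) (a : 𝔤.A), g • a ≠ 𝔤.r a) : SerreGraph where
  V := MulAction.orbitRel.Quotient G 𝔤.V
  A := MulAction.orbitRel.Quotient G 𝔤.A
  s := Quotient.map 𝔤.s (by
    rintro a b ⟨g, rfl⟩
    exact ⟨g, (hG.smul_s g b).symm⟩)
  t := Quotient.map 𝔤.t (by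
    rintro a b ⟨g, rfl⟩
    exact ⟨g, (hG.smul_t g b).symm⟩)
  r := Quotient.map 𝔤.r (by
    rintro a b ⟨g, rfl⟩
    exact ⟨g, (hG.smul_r g b).symm⟩)
  r_r := by
    rintro ⟨a⟩
    exact congrArg _ (𝔤.r_r a)
  r_ne := by
    rintro ⟨a⟩ h
    obtain ⟨g, hg⟩ := Quotient.exact h
    exact noInv g a hg
  s_r := by
    rintro ⟨a⟩
    exact congrArg _ (𝔤.s_r a)

/-- The relation identifying an edge with its reverse. -/
def unorient (𝔤 : SerreGraph) : Setoid 𝔤.A where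
  r a b := b = a ∨ b = 𝔤.r a
  iseqv :=
    { refl := fun _ => Or.inl rfl
      symm := by
        rintro a b (rfl | rfl)
        · exact Or.inl rfl
        · exact Or.inr (𝔤.r_r a).symm
      trans := by
        rintro a b c (rfl | rfl) (rfl | rfl)
        · exact Or.inl rfl
        · exact Or.inr rfl
        · exact Or.inr rfl
        · exact Or.inl (𝔤.r_r a) }

/-- The barycentric subdivision. The vertices are the vertices of `𝔤` (actual vertices) and the
unoriented edges of `𝔤` (virtual vertices, the midpoints). Each oriented edge `a` is cut into a
first half `(false, a)`, from `s a` to the midpoint, and a second half `(true, a)`, from the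
midpoint to `t a`. -/
def subdivision (𝔤 : SerreGraph) : SerreGraph where
  V := 𝔤.V ⊕ Quotient 𝔤.unorient
  A := Bool × 𝔤.A
  s
    | (false, a) => Sum.inl (𝔤.s a)
    | (true, a) => Sum.inr (Quotient.mk _ a)
  t
    | (false, a) => Sum.inr (Quotient.mk _ a)
    | (true, a) => Sum.inl (𝔤.t a)
  r p := (!p.1, 𝔤.r p.2)
  r_r p := by simp [𝔤.r_r]
  r_ne p h := by
    have := congrArg Prod.fst h
    simp at this
  s_r := by
    rintro ⟨_ | _, a⟩
    · exact congrArg Sum.inr (Quotient.sound (s := 𝔤.unorient) (Or.inr (𝔤.r_r a).symm))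
    · exact congrArg Sum.inl (𝔤.s_r a)

/-- The graph whose vertices are the vertices of `𝔤` satisfying `P` and whose edges are the paths
of length two of `𝔤`, without backtracking, that start and end at vertices satisfying `P` and whose
middle vertex does not satisfy `P`. If `𝔤` is a barycentric subdivision with actual vertices
given by `P`, this is the graph being subdivided. -/
def unsubdivide (𝔤 : SerreGraph) (P : 𝔤.V → Prop) : SerreGraph where
  V := {v : 𝔤.V // P v}
  A := {p : 𝔤.A × 𝔤.A // 𝔤.t p.1 = 𝔤.s p.2 ∧ p.2 ≠ 𝔤.r p.1 ∧
    P (𝔤.s p.1) ∧ ¬ P (𝔤.t p.1) ∧ P (𝔤.t p.2)}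
  s p := ⟨𝔤.s p.1.1, p.2.2.2.1⟩
  t p := ⟨𝔤.t p.1.2, p.2.2.2.2.2⟩
  r p := ⟨(𝔤.r p.1.2, 𝔤.r p.1.1), by
    obtain ⟨⟨a, b⟩, h1, h2, h3, h4, h5⟩ := p
    refine ⟨?_, ?_, ?_, ?_, ?_⟩
    · simpa [𝔤.s_r, 𝔤.t_r] using h1.symm
    · simpa [𝔤.r_r] using fun h => h2 h.symm
    · simpa [𝔤.s_r] using h5
    · simpa [𝔤.t_r, ← h1] using h4
    · simpa [𝔤.t_r] using h3⟩
  r_r p := Subtype.ext (Prod.ext (𝔤.r_r _) (𝔤.r_r _))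
  r_ne p h := p.2.2.1 (congrArg (fun q => q.1.2) h).symm
  s_r p := Subtype.ext (𝔤.s_r _)

end SerreGraph

/-! ### The Bruhat-Tits tree at the infinite place of `F(t)`

The completion at infinity is `F((1/t))`, written `LaurentSeries F` with variable `1/t`; its ring
of integers is `F[[1/t]]`, written `PowerSeries F`. -/

namespace InfTree

variable (F : Type) [Field F]

/-- The uniformizer `1/t`. -/
noncomputable abbrev unif : LaurentSeries F := HahnSeries.single 1 1

/-- The embedding of `F[t]` in `F((1/t))`, sending `t` to the inverse of the variable. -/
noncomputable def polyEmb : Polynomial F →+* LaurentSeries F :=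
  Polynomial.eval₂RingHom HahnSeries.C (HahnSeries.single (-1) 1)

/-- The matrix algebra over the completion. -/
abbrev Mat := Matrix (Fin 2) (Fin 2) (LaurentSeries F)

/-- `GL₂` of the completion. -/
abbrev GLK := GL (Fin 2) (LaurentSeries F)

variable {F}

/-- An order (of maximal rank): a subring containing the integers of the completion, finitely
generated as a module over them, and spanning the matrix algebra. -/
def IsOrder (D : Subalgebra (PowerSeries F) (Mat F)) : Prop :=
  (Subalgebra.toSubmodule D).FG ∧ Submodule.span (LaurentSeries F) (D : Set (Mat F)) = ⊤

/-- A maximal order. -/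
def IsMaximalOrder (D : Subalgebra (PowerSeries F) (Mat F)) : Prop := Maximal IsOrder D

variable (F) in
/-- The order of matrices with integral entries. -/
noncomputable def stdOrder : Subalgebra (PowerSeries F) (Mat F) :=
  (AlgHom.mapMatrix (m := Fin 2) (Algebra.ofId (PowerSeries F) (LaurentSeries F))).range

/-- Conjugation `g D g⁻¹`. -/
noncomputable def conj (g : GLK F) (D : Subalgebra (PowerSeries F) (Mat F)) :
    Subalgebra (PowerSeries F) (Mat F) :=
  D.map (MulSemiringAction.toAlgHom (PowerSeries F) (Mat F) (ConjAct.toConjAct g))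

theorem mem_conj {g : GLK F} {D : Subalgebra (PowerSeries F) (Mat F)} {x : Mat F} :
    x ∈ conj g D ↔ ((g⁻¹ : GLK F) : Mat F) * x * (g : Mat F) ∈ D := by
  constructor
  · rintro ⟨y, hy, rfl⟩
    have : ((g⁻¹ : GLK F) : Mat F) * ((g : Mat F) * y * ((g⁻¹ : GLK F) : Mat F)) * (g : Mat F)
        = y := by
      simp only [mul_assoc, Units.inv_mul, mul_one, Units.inv_mul_cancel_left]
    have h2 : ((g⁻¹ : GLK F) : Mat F) * ((g : Mat F) * y * ((g⁻¹ : GLK F) : Mat F)) * (g : Mat F)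
        ∈ D := by
      rw [this]; exact hy
    exact h2
  · intro h
    refine ⟨_, h, ?_⟩
    change (g : Mat F) * (((g⁻¹ : GLK F) : Mat F) * x * (g : Mat F)) * ((g⁻¹ : GLK F) : Mat F) = x
    simp only [mul_assoc, Units.mul_inv, mul_one, Units.mul_inv_cancel_left]

theorem conj_one (D : Subalgebra (PowerSeries F) (Mat F)) : conj 1 D = D := by
  ext x
  simp [mem_conj]

theorem conj_mul (g h : GLK F) (D : Subalgebra (PowerSeries F) (Mat F)) :
    conj (g * h) D = conj g (conj h D) := by
  ext x
  simp [mem_conj, mul_assoc]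

theorem conj_mono (g : GLK F) {D E : Subalgebra (PowerSeries F) (Mat F)} (h : D ≤ E) :
    conj g D ≤ conj g E := fun x hx => by
  rw [mem_conj] at hx ⊢
  exact h hx

theorem IsOrder.conj {D : Subalgebra (PowerSeries F) (Mat F)} (h : IsOrder D) (g : GLK F) :
    IsOrder (conj g D) := by
  refine ⟨h.1.map (MulSemiringAction.toAlgHom (PowerSeries F) (Mat F)
    (ConjAct.toConjAct g)).toLinearMap, ?_⟩
  have e : (InfTree.conj g D : Set (Mat F)) =
      (MulSemiringAction.toAlgHom (LaurentSeries F) (Mat F)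
        (ConjAct.toConjAct g)).toLinearMap '' (D : Set (Mat F)) := rfl
  rw [e, Submodule.span_image, h.2, Submodule.map_top, LinearMap.range_eq_top]
  exact MulAction.surjective (ConjAct.toConjAct g)

theorem IsMaximalOrder.conj {D : Subalgebra (PowerSeries F) (Mat F)} (h : IsMaximalOrder D)
    (g : GLK F) : IsMaximalOrder (conj g D) := by
  refine ⟨h.1.conj g, fun E hE hDE => ?_⟩
  have h1 := conj_mono g⁻¹ hDE
  rw [← conj_mul, inv_mul_cancel, conj_one] at h1
  have h2 := conj_mono g (h.2 (hE.conj g⁻¹) h1)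
  rwa [← conj_mul, mul_inv_cancel, conj_one] at h2

theorem mem_stdOrder {x : Mat F} :
    x ∈ stdOrder F ↔
      ∀ i j, ∃ p : PowerSeries F, algebraMap (PowerSeries F) (LaurentSeries F) p = x i j := by
  constructor
  · rintro ⟨y, rfl⟩ i j
    exact ⟨y i j, rfl⟩
  · intro h
    choose y hy using h
    exact ⟨Matrix.of y, by ext1 i j; exact hy i j⟩

theorem single_mem_stdOrder (i j : Fin 2) : Matrix.single i j 1 ∈ stdOrder F := by
  rw [mem_stdOrder]
  intro a b
  by_cases h : i = a ∧ j = b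
  · exact ⟨1, by simp [Matrix.single, h]⟩
  · exact ⟨0, by simp [Matrix.single, h]⟩

theorem isOrder_stdOrder : IsOrder (stdOrder F) := by
  constructor
  · have : (Subalgebra.toSubmodule (stdOrder F)) = LinearMap.range
        (AlgHom.mapMatrix (m := Fin 2)
          (Algebra.ofId (PowerSeries F) (LaurentSeries F))).toLinearMap := rfl
    rw [this]
    exact Submodule.FG.of_finite
  · rw [eq_top_iff]
    intro x _
    rw [Matrix.matrix_eq_sum_single x]
    refine Submodule.sum_mem _ fun i _ => Submodule.sum_mem _ fun j _ => ?_
    have : Matrix.single i j (x i j) = x i j • Matrix.single i j (1 : LaurentSeries F) := by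
      simp [Matrix.smul_single]
    rw [this]
    exact Submodule.smul_mem _ _ (Submodule.subset_span (single_mem_stdOrder i j))

theorem isMaximalOrder_stdOrder : IsMaximalOrder (stdOrder F) := by
  refine ⟨isOrder_stdOrder, fun E hE hle x hx => ?_⟩
  rw [mem_stdOrder]
  intro i j
  have hmem : algebraMap (LaurentSeries F) (Mat F) (x i j) ∈ E := by
    have e : algebraMap (LaurentSeries F) (Mat F) (x i j) =
        ∑ k, Matrix.single k i 1 * x * Matrix.single j k 1 := by
      rw [Matrix.algebraMap_eq_diagonal]
      ext1 a b
      fin_cases i <;> fin_cases j <;> fin_cases a <;> fin_cases b <;>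
        simp [Matrix.mul_apply, Matrix.single, Fin.sum_univ_two]
    rw [e]
    exact sum_mem fun k _ => mul_mem (mul_mem (hle (single_mem_stdOrder k i)) hx)
      (hle (single_mem_stdOrder j k))
  have hint : IsIntegral (PowerSeries F) (algebraMap (LaurentSeries F) (Mat F) (x i j)) :=
    IsIntegral.of_mem_of_fg E hE.1 _ hmem
  rw [isIntegral_algebraMap_iff (algebraMap (LaurentSeries F) (Mat F)).injective] at hint
  exact IsIntegrallyClosed.isIntegral_iff.mp hint

variable (F) in
/-- The matrix `diag(π, 1)`, where `π` is the uniformizer. -/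
noncomputable def diagUnif : GLK F :=
  Matrix.GeneralLinearGroup.mkOfDetNeZero !![unif F, 0; 0, 1] (by simp [Matrix.det_fin_two])

/-- Two maximal orders are neighbors if in some basis the first is `[[O, O], [O, O]]` and the
second is `[[O, πO], [π⁻¹O, O]]`, which is `diag(π, 1) M₂(O) diag(π, 1)⁻¹`. -/
def Neighbors (D E : Subalgebra (PowerSeries F) (Mat F)) : Prop :=
  ∃ g : GLK F, D = conj g (stdOrder F) ∧ E = conj g (conj (diagUnif F) (stdOrder F))

theorem Neighbors.conj {D E : Subalgebra (PowerSeries F) (Mat F)} (h : Neighbors D E)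
    (g : GLK F) : Neighbors (conj g D) (conj g E) := by
  obtain ⟨k, rfl, rfl⟩ := h
  exact ⟨g * k, (conj_mul g k _).symm, (conj_mul g k _).symm⟩

variable (F) in
/-- The matrix `[[0, 1], [1, 0]]`. -/
noncomputable def swapK : GLK F :=
  Matrix.GeneralLinearGroup.mkOfDetNeZero !![0, 1; 1, 0] (by simp [Matrix.det_fin_two])

theorem conj_swapK : conj (swapK F) (stdOrder F) = stdOrder F := by
  have h1 : ((swapK F : GLK F) : Mat F) = !![0, 1; 1, 0] := rfl
  have hsq : swapK F * swapK F = 1 := by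
    ext i j
    rw [Units.val_mul, h1]
    fin_cases i <;> fin_cases j <;> simp [Matrix.mul_apply, Fin.sum_univ_two]
  have hmem : ((swapK F : GLK F) : Mat F) ∈ stdOrder F := by
    rw [mem_stdOrder, h1]
    intro i j
    fin_cases i <;> fin_cases j
    · exact ⟨0, by simp⟩
    · exact ⟨1, by simp⟩
    · exact ⟨1, by simp⟩
    · exact ⟨0, by simp⟩
  have hle : conj (swapK F) (stdOrder F) ≤ stdOrder F := by
    rintro x ⟨y, hy, rfl⟩
    change ((swapK F : GLK F) : Mat F) * y * (((swapK F)⁻¹ : GLK F) : Mat F) ∈ stdOrder F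
    rw [inv_eq_of_mul_eq_one_left hsq]
    exact mul_mem (mul_mem hmem hy) hmem
  refine le_antisymm hle ?_
  have h2 := conj_mono (swapK F) hle
  rwa [← conj_mul, hsq, conj_one] at h2

theorem conj_diagUnif_swapK :
    conj (diagUnif F * swapK F * diagUnif F) (stdOrder F) = stdOrder F := by
  have e : ((diagUnif F * swapK F * diagUnif F : GLK F) : Mat F) =
      unif F • ((swapK F : GLK F) : Mat F) := by
    rw [Units.val_mul, Units.val_mul]
    change !![unif F, 0; 0, 1] * !![0, 1; 1, 0] * !![unif F, 0; 0, 1] =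
      unif F • !![0, 1; 1, 0]
    ext1 i j
    fin_cases i <;> fin_cases j <;> simp [Matrix.mul_apply, Fin.sum_univ_two]
  conv_rhs => rw [← conj_swapK]
  ext x
  have h0 : unif F ≠ 0 := by simp
  have e' : (((diagUnif F * swapK F * diagUnif F)⁻¹ : GLK F) : Mat F) =
      (unif F)⁻¹ • (((swapK F)⁻¹ : GLK F) : Mat F) := by
    refine Units.inv_eq_of_mul_eq_one_right ?_
    rw [e, Matrix.smul_mul, Matrix.mul_smul, smul_smul, mul_inv_cancel₀ h0, Units.mul_inv, one_smul]
  rw [mem_conj, mem_conj, e, e', Matrix.smul_mul, Matrix.smul_mul, Matrix.mul_smul, smul_smul,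
    inv_mul_cancel₀ h0, one_smul]

theorem Neighbors.symm {D E : Subalgebra (PowerSeries F) (Mat F)} (h : Neighbors D E) :
    Neighbors E D := by
  obtain ⟨g, rfl, rfl⟩ := h
  refine ⟨g * diagUnif F * swapK F, ?_, ?_⟩
  · rw [conj_mul, conj_swapK, conj_mul]
  · rw [← conj_mul, mul_assoc, mul_assoc, conj_mul, ← mul_assoc, conj_diagUnif_swapK]

theorem addVal_nonneg (p : PowerSeries F) :
    0 ≤ HahnSeries.addVal ℤ F (algebraMap (PowerSeries F) (LaurentSeries F) p) := by
  rw [HahnSeries.addVal_apply]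
  refine HahnSeries.le_orderTop_iff_forall.mpr fun j hj => ?_
  rw [LaurentSeries.coe_algebraMap, PowerSeries.coeff_coe, if_pos (by simpa using hj)]

/-- A matrix normalizing `M₂(O)` has a determinant of even valuation. -/
theorem addVal_det_even {g : GLK F} (h : conj g (stdOrder F) = stdOrder F) :
    ∃ n : ℤ, HahnSeries.addVal ℤ F ((g : Mat F).det) = ((2 * n : ℤ) : WithTop ℤ) := by
  set v := HahnSeries.addVal ℤ F with hv
  set M : Mat F := (g : Mat F) with hM
  have hdet : M.det ≠ 0 := (Matrix.isUnits_det_units g).ne_zero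
  obtain ⟨⟨k, i⟩, hmin⟩ := Finite.exists_min (fun p : Fin 2 × Fin 2 => v (M p.1 p.2))
  have hmin' : ∀ a b, v (M k i) ≤ v (M a b) := fun a b => hmin (a, b)
  set c := v (M k i) with hc
  have hle : c + c ≤ v M.det := by
    rw [Matrix.det_fin_two]
    refine le_trans (le_min ?_ ?_) (v.map_sub _ _) <;> rw [v.map_mul] <;>
      exact add_le_add (hmin' _ _) (hmin' _ _)
  obtain ⟨a, b, hab⟩ : ∃ a b, v (M.adjugate a b) = c := by
    rw [Matrix.adjugate_fin_two]
    fin_cases k <;> fin_cases i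
    · exact ⟨1, 1, by simp [hc]⟩
    · exact ⟨0, 1, by simp [hc, v.map_neg]⟩
    · exact ⟨1, 0, by simp [hc, v.map_neg]⟩
    · exact ⟨0, 0, by simp [hc]⟩
  have hge : v M.det ≤ c + c := by
    have hmem : M * Matrix.single i a 1 * (((g)⁻¹ : GLK F) : Mat F) ∈ stdOrder F := by
      rw [← h]
      exact ⟨_, single_mem_stdOrder i a, rfl⟩
    rw [mem_stdOrder] at hmem
    obtain ⟨p, hp⟩ := hmem k b
    have hadj : M.det • (((g)⁻¹ : GLK F) : Mat F) = M.adjugate := by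
      have : (((g)⁻¹ : GLK F) : Mat F) = M⁻¹ := Matrix.coe_units_inv g
      rw [this, Matrix.inv_def, smul_smul, Ring.mul_inverse_cancel _ (Matrix.isUnits_det_units g),
        one_smul]
    have key : M.det * algebraMap (PowerSeries F) (LaurentSeries F) p =
        M k i * M.adjugate a b := by
      rw [hp, ← hadj]
      fin_cases i <;> fin_cases a <;>
        simp [Matrix.mul_apply, Fin.sum_univ_two, Matrix.single] <;> ring
    have := congrArg v key
    rw [v.map_mul, v.map_mul, hab] at this
    rw [← this]
    exact le_add_of_nonneg_right (addVal_nonneg p)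
  have heq := le_antisymm hge hle
  have hfin : v M.det ≠ ⊤ := by
    rw [Ne, v.top_iff]; exact hdet
  cases hcc : c with
  | top => rw [hcc] at heq; exact absurd heq hfin
  | coe n =>
    refine ⟨n, ?_⟩
    rw [heq, hcc, two_mul]
    rfl

theorem addVal_unif : HahnSeries.addVal ℤ F (unif F) = ((1 : ℤ) : WithTop ℤ) := by
  rw [HahnSeries.addVal_apply, HahnSeries.orderTop_single one_ne_zero]

theorem det_diagUnif : ((diagUnif F : GLK F) : Mat F).det = unif F := by
  change (!![unif F, 0; 0, 1] : Mat F).det = unif F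
  simp [Matrix.det_fin_two]

theorem Neighbors.ne {D E : Subalgebra (PowerSeries F) (Mat F)} (h : Neighbors D E) : E ≠ D := by
  obtain ⟨g, rfl, rfl⟩ := h
  intro h
  have h1 := congrArg (InfTree.conj g⁻¹) h
  rw [← conj_mul, inv_mul_cancel, conj_one, ← conj_mul, inv_mul_cancel, conj_one] at h1
  obtain ⟨n, hn⟩ := addVal_det_even h1
  rw [det_diagUnif, addVal_unif, WithTop.coe_inj] at hn
  omega

variable (F) in
/-- The Bruhat-Tits tree: its vertices are the maximal orders. -/
def tree : SerreGraph where
  V := {D : Subalgebra (PowerSeries F) (Mat F) // IsMaximalOrder D}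
  A := {p : {D : Subalgebra (PowerSeries F) (Mat F) // IsMaximalOrder D} ×
      {D : Subalgebra (PowerSeries F) (Mat F) // IsMaximalOrder D} // Neighbors p.1.1 p.2.1}
  s p := p.1.1
  t p := p.1.2
  r p := ⟨(p.1.2, p.1.1), p.2.symm⟩
  r_r _ := rfl
  r_ne p h := p.2.ne (congrArg (fun q => q.1.1.1) h)
  s_r _ := rfl

/-- The vertex corresponding to the ball with center `a` and radius `|π ^ r|`, namely the order
`End ⟨(a, 1), (π ^ r, 0)⟩`. -/
noncomputable def ballOrder (a : LaurentSeries F) (r : ℤ) : (tree F).V :=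
  ⟨conj (Matrix.GeneralLinearGroup.mkOfDetNeZero !![a, HahnSeries.single r 1; 1, 0]
    (by simp [Matrix.det_fin_two])) (stdOrder F), isMaximalOrder_stdOrder.conj _⟩

variable (F) in
/-- `GL₂(F[t])`. -/
abbrev GLPoly := GL (Fin 2) (Polynomial F)

/-- The embedding of `GL₂(F[t])` in `GL₂` of the completion. -/
noncomputable def glEmb : GLPoly F →* GLK F := Matrix.GeneralLinearGroup.map (polyEmb F)

/-- The action of `GL₂(F[t])` on the vertices, by conjugation. -/
noncomputable instance : MulAction (GLPoly F) (tree F).V where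
  smul g D := ⟨conj (glEmb g) D.1, D.2.conj _⟩
  one_smul D := Subtype.ext (by
    change conj (glEmb 1) D.1 = D.1
    rw [map_one, conj_one])
  mul_smul g h D := Subtype.ext (by
    change conj (glEmb (g * h)) D.1 = conj (glEmb g) (conj (glEmb h) D.1)
    rw [map_mul, conj_mul])

/-- The action of `GL₂(F[t])` on the edges, by conjugation. -/
noncomputable instance : MulAction (GLPoly F) (tree F).A where
  smul g p := ⟨(g • (show (tree F).V from p.1.1), g • (show (tree F).V from p.1.2)),
    p.2.conj (glEmb g)⟩
  one_smul p := Subtype.ext (Prod.ext (one_smul (GLPoly F) (show (tree F).V from p.1.1))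
    (one_smul (GLPoly F) (show (tree F).V from p.1.2)))
  mul_smul g h p := Subtype.ext (Prod.ext (mul_smul g h (show (tree F).V from p.1.1))
    (mul_smul g h (show (tree F).V from p.1.2)))

instance (Γ : Subgroup (GLPoly F)) : SerreGraph.ActsOn Γ (tree F) where
  smul_s _ _ := rfl
  smul_t _ _ := rfl
  smul_r _ _ := rfl

theorem addVal_det_glEmb (g : GLPoly F) :
    HahnSeries.addVal ℤ F ((glEmb g : GLK F) : Mat F).det = ((0 : ℤ) : WithTop ℤ) := by
  have h : ((glEmb g : GLK F) : Mat F).det = polyEmb F (g : Matrix (Fin 2) (Fin 2) (Polynomial F)).det :=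
    ((polyEmb F).map_det (g : Matrix (Fin 2) (Fin 2) (Polynomial F))).symm
  obtain ⟨c, hc, hc'⟩ := Polynomial.isUnit_iff.mp (Matrix.isUnits_det_units g)
  rw [h, ← hc', polyEmb, Polynomial.coe_eval₂RingHom, Polynomial.eval₂_C, HahnSeries.addVal_apply,
    HahnSeries.C_apply, HahnSeries.orderTop_single hc.ne_zero]

/-- `GL₂(F[t])` acts on the tree without inversions. -/
theorem noInversions (g : GLPoly F) (a : (tree F).A) : g • a ≠ (tree F).r a := by
  obtain ⟨⟨⟨D, hD⟩, ⟨E, hE⟩⟩, k, hk1, hk2⟩ := a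
  intro h
  dsimp only at hk1 hk2
  have h1 : conj (glEmb g) D = E := congrArg (fun q => q.1.1.1) h
  rw [hk1, hk2] at h1
  have h2 : conj ((diagUnif F)⁻¹ * (k⁻¹ * glEmb g * k)) (stdOrder F) = stdOrder F := by
    rw [conj_mul, mul_assoc, conj_mul k⁻¹, conj_mul, h1, ← conj_mul k⁻¹, inv_mul_cancel, conj_one,
      ← conj_mul, inv_mul_cancel, conj_one]
  obtain ⟨n, hn⟩ := addVal_det_even h2
  have h3 : ((diagUnif F : GLK F) : Mat F).det *
      (((diagUnif F)⁻¹ * (k⁻¹ * glEmb g * k) : GLK F) : Mat F).det =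
      ((glEmb g : GLK F) : Mat F).det := by
    have e : diagUnif F * ((diagUnif F)⁻¹ * (k⁻¹ * glEmb g * k)) = k⁻¹ * glEmb g * k := by group
    rw [← Matrix.det_mul, ← Units.val_mul, e, Units.val_mul, Units.val_mul]
    exact Matrix.det_units_conj' k _
  have h4 := congrArg (HahnSeries.addVal ℤ F) h3
  rw [AddValuation.map_mul, hn, addVal_det_glEmb, det_diagUnif, addVal_unif, ← WithTop.coe_add,
    WithTop.coe_inj] at h4
  omega

/-- The principal congruence subgroup of level `f`: the matrices in `GL₂(F[t])` that are congruent
to the identity modulo `f`. -/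
noncomputable def Gam (f : Polynomial F) : Subgroup (GLPoly F) :=
  (Matrix.GeneralLinearGroup.map (n := Fin 2) (Ideal.Quotient.mk (Ideal.span {f}))).ker

/-- The quotient of the tree by the principal congruence subgroup of level `f`. -/
noncomputable def quotGraph (f : Polynomial F) : SerreGraph :=
  (tree F).quotient (Gam f) fun g a => noInversions g.1 a

/-- A vertex of the quotient is of type `n` if it has a lift to the tree in the `GL₂(F[t])`-orbit of
the ball with center `0` and radius `|t ^ n|`. -/
def IsType (f : Polynomial F) (n : ℕ) (x : (quotGraph f).V) : Prop :=
  ∃ g : GLPoly F, x = Quotient.mk _ (g • ballOrder (0 : LaurentSeries F) (-(n : ℤ)))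

/-- The largest subgraph of the quotient whose vertices are of type `0` or `1`. -/
noncomputable def graphA (f : Polynomial F) : SerreGraph :=
  (quotGraph f).induce fun x => IsType f 0 x ∨ IsType f 1 x

/-- Being of type `0`, for vertices of the subgraph `graphA f`. -/
def TypeZero (f : Polynomial F) (x : (graphA f).V) : Prop := IsType f 0 x.1

/-- The graph on the type `0` vertices whose edges are the paths of length two, without
backtracking, through a type `1` vertex. -/
noncomputable def graphO (f : Polynomial F) : SerreGraph :=
  (graphA f).unsubdivide (TypeZero f)

end InfTree

/-! ### The three graphs -/

/-- The complete bipartite graph `K₃,₃`. -/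
def graphK33 : SimpleGraph (Fin 3 ⊕ Fin 3) := completeBipartiteGraph (Fin 3) (Fin 3)

/-- The 1-skeleton of the cube with vertex set `{0, 1}³`: two vertices are adjacent if they differ in
exactly one coordinate. -/
def cubeGraph : SimpleGraph (Fin 3 → Fin 2) where
  Adj x y := hammingDist x y = 1
  symm := ⟨fun x y h => by rw [hammingDist_comm]; exact h⟩
  loopless := ⟨fun x h => by simp at h⟩

/-- The Petersen graph: the vertices are the two-element subsets of a five-element set, and two of
them are adjacent if they are disjoint. -/
def petersenGraph : SimpleGraph {S : Finset (Fin 5) // S.card = 2} where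
  Adj S T := Disjoint S.1 T.1
  symm := ⟨fun _ _ h => h.symm⟩
  loopless := ⟨fun S h => by
    have h0 := disjoint_self.mp h
    have := S.2
    rw [h0] at this
    simp at this⟩

/-! Every unit of F₂[t] is 1, so G = GL₂(F₂[t]) equals SL₂(F₂[t]). Evaluation at the root ω of f =
t² + bt + a maps G onto SL₂(R), where R = F₂[t]/(f) = F₂[ω], with kernel Γ(f) (`mem_Gam_iff`,
`exists_redG_eq`). An orbit of G in the tree thus becomes, in the quotient, the set of cosets in
SL₂(R) of the reduction of a stabilizer.

Let v₀, v₁ be the vertices of types 0 and 1 on the standard ray. The stabilizer of v₀ is K =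
GL₂(F₂), which is transitive on the neighbors of v₀; the stabilizer of v₁ consists of the matrices
[[1, x + yt], [0, 1]], and those with y = 0 fix the edge v₀v₁. Hence every type-1 vertex lies on
exactly two edges of 𝔞 (`exists_two_edges`). The parity of the valuation of a determinant
two-colours the tree and G preserves the colours, so each edge of 𝔞 joins type 0 to type 1
(`typeZero_s_iff`). By `exists_iso_subdivision`, 𝔞 is a subdivision of 𝔬.

The vertices of 𝔬 are the cosets SL₂(R)/K, and its edges join gK to guK with u = [[1, ω], [0, 1]].
Elements of K ∩ uKu⁻¹ fix the edge v₀v₁, so there are no multiple edges (`graphO_A_ext`). Write a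
matrix over R as A + ωB. Then K is given by B = 0 and KuK by B nonzero and singular, so adjacency of
gK and hK is read off the imaginary part B of g⁻¹h. `nonempty_graphO_iso` reduces each case to a
finite check on coset representatives, with R = F₂ × F₂, F₂[ε] and F₄. -/

namespace SerreGraph

/-! ### Recognizing barycentric subdivisions and simple graphs. -/

variable {𝔤 : SerreGraph} {P : 𝔤.V → Prop}

/-- A graph in which every edge has exactly one endpoint satisfying `P`, and in which every vertex
not satisfying `P` has exactly two outgoing edges, is a barycentric subdivision. -/
theorem exists_iso_subdivision (hP : ∀ a, P (𝔤.s a) ↔ ¬ P (𝔤.t a))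
    (h2 : ∀ x, ¬ P x → ∃ e₁ e₂, e₁ ≠ e₂ ∧ 𝔤.s e₁ = x ∧ 𝔤.s e₂ = x ∧
      ∀ e, 𝔤.s e = x → e = e₁ ∨ e = e₂) :
    ∃ φ : 𝔤.Iso (𝔤.unsubdivide P).subdivision,
      ∀ x, P x ↔ ∃ v : (𝔤.unsubdivide P).V, φ.onV x = Sum.inl v := by
  classical
  have hother : ∀ x, ¬ P x → ∀ e, 𝔤.s e = x →
      ∃ e', (𝔤.s e' = x ∧ e' ≠ e) ∧ ∀ e'', 𝔤.s e'' = x → e'' ≠ e → e'' = e' := by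
    intro x hx e he
    obtain ⟨e₁, e₂, hne, h₁, h₂, h⟩ := h2 x hx
    rcases h e he with rfl | rfl
    · exact ⟨e₂, ⟨h₂, hne.symm⟩, fun e'' h1 h2 => (h e'' h1).resolve_left h2⟩
    · exact ⟨e₁, ⟨h₁, hne⟩, fun e'' h1 h2 => (h e'' h1).resolve_right h2⟩
  -- the edge continuing `a`
  have hnext : ∀ a : 𝔤.A, P (𝔤.s a) → ∃ b : 𝔤.A, (𝔤.t a = 𝔤.s b ∧ b ≠ 𝔤.r a) ∧
      ∀ b', 𝔤.t a = 𝔤.s b' → b' ≠ 𝔤.r a → b' = b := by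
    intro a ha
    obtain ⟨b, ⟨h1, h2⟩, h3⟩ := hother (𝔤.t a) ((hP a).1 ha) (𝔤.r a) (𝔤.s_r a)
    exact ⟨b, ⟨h1.symm, h2⟩, fun b' h h' => h3 b' h.symm h'⟩
  choose! nx hnx hnxu using hnext
  have hpath : ∀ a, P (𝔤.s a) → 𝔤.t a = 𝔤.s (nx a) ∧ nx a ≠ 𝔤.r a ∧
      P (𝔤.s a) ∧ ¬ P (𝔤.t a) ∧ P (𝔤.t (nx a)) := by
    intro a ha
    refine ⟨(hnx a ha).1, (hnx a ha).2, ha, (hP a).1 ha, ?_⟩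
    by_contra h
    exact (hP a).1 ha ((hnx a ha).1 ▸ (hP (nx a)).2 h)
  let pa : (a : 𝔤.A) → P (𝔤.s a) → (𝔤.unsubdivide P).A := fun a ha => ⟨(a, nx a), hpath a ha⟩
  have hpa : ∀ (p : (𝔤.unsubdivide P).A), p = pa p.1.1 p.2.2.2.1 := by
    rintro ⟨⟨a, b⟩, h1, h2, h3, h4, h5⟩
    exact Subtype.ext (Prod.ext rfl (hnxu a h3 b h1 h2))
  have hPr : ∀ a, ¬ P (𝔤.s a) → P (𝔤.s (𝔤.r a)) := by
    intro a ha
    rw [𝔤.s_r]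
    by_contra h
    exact ha ((hP a).2 h)
  have hPr' : ∀ a, P (𝔤.s a) → ¬ P (𝔤.s (𝔤.r a)) := by
    intro a ha
    rw [𝔤.s_r]
    exact (hP a).1 ha
  -- the path with midpoint `x`
  have hmid : ∀ x, ¬ P x → ∃ a : 𝔤.A, P (𝔤.s a) ∧ 𝔤.t a = x := by
    intro x hx
    obtain ⟨e₁, -, -, h1, -⟩ := h2 x hx
    exact ⟨𝔤.r e₁, hPr _ (by rwa [h1]), by rw [𝔤.t_r, h1]⟩
  choose mi hmiP hmi using hmid
  -- The choice of `mi` is harmless: the two paths through a given midpoint are reverse to each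
  -- other, so they define the same unoriented edge (`hsame`).
  let fV : 𝔤.V → (𝔤.unsubdivide P).subdivision.V := fun x =>
    if hx : P x then Sum.inl ⟨x, hx⟩ else Sum.inr (Quotient.mk _ (pa (mi x hx) (hmiP x hx)))
  have hfV1 : ∀ x (hx : P x), fV x = Sum.inl ⟨x, hx⟩ := fun x hx => dif_pos hx
  have hsame : ∀ a b (ha : P (𝔤.s a)) (hb : P (𝔤.s b)), 𝔤.t a = 𝔤.t b →
      (𝔤.unsubdivide P).unorient (pa a ha) (pa b hb) := by
    intro a b ha hb hab
    by_cases h : b = a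
    · subst h; exact Or.inl rfl
    · right
      have h1 : 𝔤.r b = nx a := by
        refine hnxu a ha _ (by rw [𝔤.s_r, hab]) fun h' => h ?_
        rw [← 𝔤.r_r b, h', 𝔤.r_r]
      rw [hpa ((𝔤.unsubdivide P).r (pa a ha))]
      have : b = 𝔤.r (nx a) := by rw [← h1, 𝔤.r_r]
      subst this
      rfl
  have hsame' : ∀ a b (ha : P (𝔤.s a)) (hb : P (𝔤.s b)),
      (𝔤.unsubdivide P).unorient (pa a ha) (pa b hb) → 𝔤.t a = 𝔤.t b := by
    rintro a b ha hb (h | h)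
    · have := congrArg (fun p => p.1.1) h
      exact congrArg 𝔤.t this.symm
    · have : b = 𝔤.r (nx a) := congrArg (fun p => p.1.1) h
      rw [this, 𝔤.t_r, (hnx a ha).1]
  have hfV2 : ∀ a (ha : P (𝔤.s a)), fV (𝔤.t a) = Sum.inr (Quotient.mk _ (pa a ha)) := by
    intro a ha
    have hx := (hP a).1 ha
    have : fV (𝔤.t a) = Sum.inr (Quotient.mk _ (pa (mi (𝔤.t a) hx) (hmiP _ hx))) := dif_neg hx
    rw [this]
    exact congrArg Sum.inr (Quotient.sound (hsame _ _ (hmiP _ hx) ha (hmi _ hx)))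
  have hV : Function.Bijective fV := by
    constructor
    · intro x y hxy
      by_cases hx : P x
      · by_cases hy : P y
        · rw [hfV1 x hx, hfV1 y hy] at hxy
          exact congrArg Subtype.val (Sum.inl.inj hxy)
        · rw [hfV1 x hx, ← hmi y hy, hfV2 _ (hmiP y hy)] at hxy
          cases hxy
      · by_cases hy : P y
        · rw [hfV1 y hy, ← hmi x hx, hfV2 _ (hmiP x hx)] at hxy
          cases hxy
        · rw [← hmi x hx, ← hmi y hy, hfV2 _ (hmiP x hx), hfV2 _ (hmiP y hy)] at hxy
          rw [← hmi x hx, ← hmi y hy]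
          exact hsame' _ _ (hmiP x hx) (hmiP y hy) (Quotient.exact (Sum.inr.inj hxy))
    · rintro (⟨x, hx⟩ | q)
      · exact ⟨x, hfV1 x hx⟩
      · induction q using Quotient.inductionOn with
        | _ p => exact ⟨𝔤.t p.1.1, by rw [hfV2 _ p.2.2.2.1, ← hpa p]⟩
  -- An edge leaving a vertex with `P` is the first half of the path it begins. Any other edge is
  -- the reverse of such a first half, hence the second half of the reversed path.
  let fA : 𝔤.A → (𝔤.unsubdivide P).subdivision.A := fun a =>
    if ha : P (𝔤.s a) then (false, pa a ha)
    else (true, (𝔤.unsubdivide P).r (pa (𝔤.r a) (hPr a ha)))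
  have hfA1 : ∀ a (ha : P (𝔤.s a)), fA a = (false, pa a ha) := fun a ha => dif_pos ha
  have hfA2 : ∀ a (ha : P (𝔤.s a)), fA (𝔤.r a) = (true, (𝔤.unsubdivide P).r (pa a ha)) := by
    intro a ha
    have h : fA (𝔤.r a) = (true, (𝔤.unsubdivide P).r (pa (𝔤.r (𝔤.r a)) (hPr _ (hPr' a ha)))) :=
      dif_neg (hPr' a ha)
    rw [h]
    have : ∀ c (hc : P (𝔤.s c)), c = a → pa c hc = pa a ha := by rintro c hc rfl; rfl
    rw [this _ (by rwa [𝔤.r_r]) (𝔤.r_r a)]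
  have hcase : ∀ a, ¬ P (𝔤.s a) → ∃ b, P (𝔤.s b) ∧ a = 𝔤.r b := fun a ha =>
    ⟨𝔤.r a, hPr a ha, (𝔤.r_r a).symm⟩
  have hpainj : ∀ a b (ha : P (𝔤.s a)) (hb : P (𝔤.s b)), pa a ha = pa b hb → a = b :=
    fun a b ha hb h => congrArg (fun p => p.1.1) h
  have hA : Function.Bijective fA := by
    constructor
    · intro a b hab
      by_cases ha : P (𝔤.s a)
      · by_cases hb : P (𝔤.s b)
        · rw [hfA1 a ha, hfA1 b hb] at hab
          exact hpainj _ _ ha hb (congrArg Prod.snd hab)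
        · obtain ⟨b, hb', rfl⟩ := hcase b hb
          rw [hfA1 a ha, hfA2 b hb'] at hab
          exact absurd (congrArg Prod.fst hab) Bool.false_ne_true
      · obtain ⟨a, ha', rfl⟩ := hcase a ha
        by_cases hb : P (𝔤.s b)
        · rw [hfA1 b hb, hfA2 a ha'] at hab
          exact absurd (congrArg Prod.fst hab).symm Bool.false_ne_true
        · obtain ⟨b, hb', rfl⟩ := hcase b hb
          rw [hfA2 a ha', hfA2 b hb'] at hab
          have := congrArg (𝔤.unsubdivide P).r (congrArg Prod.snd hab)
          rw [(𝔤.unsubdivide P).r_r, (𝔤.unsubdivide P).r_r] at this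
          rw [hpainj _ _ ha' hb' this]
    · rintro ⟨_ | _, p⟩
      · exact ⟨p.1.1, by rw [hfA1 _ p.2.2.2.1, ← hpa p]⟩
      · set q := (𝔤.unsubdivide P).r p with hq
        refine ⟨𝔤.r q.1.1, ?_⟩
        rw [hfA2 _ q.2.2.2.1, ← hpa q, hq, (𝔤.unsubdivide P).r_r]
  have hmaps : ∀ a, (𝔤.unsubdivide P).subdivision.s (fA a) = fV (𝔤.s a) := by
    intro a
    by_cases ha : P (𝔤.s a)
    · rw [hfA1 a ha, hfV1 _ ha]; rfl
    · obtain ⟨a, ha', rfl⟩ := hcase a ha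
      rw [hfA2 a ha', 𝔤.s_r, hfV2 a ha']
      exact congrArg Sum.inr (Quotient.sound (Setoid.symm' _ (Or.inr rfl)))
  have hmapr : ∀ a, (𝔤.unsubdivide P).subdivision.r (fA a) = fA (𝔤.r a) := by
    intro a
    by_cases ha : P (𝔤.s a)
    · rw [hfA1 a ha, hfA2 a ha]; rfl
    · obtain ⟨a, ha', rfl⟩ := hcase a ha
      rw [hfA2 a ha', 𝔤.r_r, hfA1 a ha']
      exact Prod.ext rfl ((𝔤.unsubdivide P).r_r _)
  refine ⟨⟨Equiv.ofBijective fV hV, Equiv.ofBijective fA hA, hmaps, ?_, hmapr⟩, ?_⟩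
  · intro a
    change (𝔤.unsubdivide P).subdivision.t (fA a) = fV (𝔤.t a)
    rw [← SerreGraph.s_r, hmapr, hmaps, 𝔤.s_r]
  · intro x
    change _ ↔ ∃ v, fV x = Sum.inl v
    constructor
    · exact fun hx => ⟨_, hfV1 x hx⟩
    · rintro ⟨v, hv⟩
      by_contra hx
      rw [← hmi x hx, hfV2 _ (hmiP x hx)] at hv
      cases hv

/-- A graph without multiple edges is determined by its adjacency relation. -/
theorem nonempty_iso_ofSimpleGraph {W : Type} {G : SimpleGraph W} (F : 𝔤.V → W)
    (hF : Function.Bijective F) (hadj : ∀ a, G.Adj (F (𝔤.s a)) (F (𝔤.t a)))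
    (huniq : ∀ a b, 𝔤.s a = 𝔤.s b → 𝔤.t a = 𝔤.t b → a = b)
    (hex : ∀ x y, G.Adj (F x) (F y) → ∃ a, 𝔤.s a = x ∧ 𝔤.t a = y) :
    Nonempty (𝔤.Iso (ofSimpleGraph G)) := by
  let fA : 𝔤.A → G.Dart := fun a => ⟨(F (𝔤.s a), F (𝔤.t a)), hadj a⟩
  have hA : Function.Bijective fA := by
    constructor
    · intro a b hab
      have := congrArg SimpleGraph.Dart.toProd hab
      exact huniq a b (hF.1 (congrArg Prod.fst this)) (hF.1 (congrArg Prod.snd this))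
    · rintro ⟨⟨x, y⟩, hxy⟩
      obtain ⟨x, rfl⟩ := hF.2 x
      obtain ⟨y, rfl⟩ := hF.2 y
      obtain ⟨a, rfl, rfl⟩ := hex x y hxy
      exact ⟨a, rfl⟩
  refine ⟨⟨Equiv.ofBijective F hF, Equiv.ofBijective fA hA, fun _ => rfl, fun _ => rfl, ?_⟩⟩
  intro a
  refine SimpleGraph.Dart.ext _ _ (Prod.ext ?_ ?_)
  · exact congrArg F (𝔤.s_r a).symm
  · exact congrArg F (𝔤.t_r a).symm

end SerreGraph

namespace InfTree

open Matrix

variable {F : Type} [Field F]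

/-! ### Maximal orders and determinants -/

theorem mem_range_algebraMap_iff {x : LaurentSeries F} :
    (∃ p : PowerSeries F, algebraMap (PowerSeries F) (LaurentSeries F) p = x) ↔
      ∀ n < 0, x.coeff n = 0 := by
  constructor
  · rintro ⟨p, rfl⟩ n hn
    rw [LaurentSeries.coe_algebraMap, PowerSeries.coeff_coe, if_pos hn]
  · intro h
    refine ⟨PowerSeries.mk fun n => x.coeff n, ?_⟩
    ext n
    rw [LaurentSeries.coe_algebraMap, PowerSeries.coeff_coe]
    split_ifs with hn
    · rw [h n hn]
    · rw [PowerSeries.coeff_mk, Int.natAbs_of_nonneg (not_lt.1 hn)]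

theorem mem_range_algebraMap_of_order_nonneg {x : LaurentSeries F} (h : 0 ≤ x.order) :
    ∃ p : PowerSeries F, algebraMap (PowerSeries F) (LaurentSeries F) p = x :=
  mem_range_algebraMap_iff.2 fun _ hn => HahnSeries.coeff_eq_zero_of_lt_order (hn.trans_le h)

/-- The order (valuation) of the determinant. -/
noncomputable def ordDet (g : GLK F) : ℤ := (g : Mat F).det.order

theorem det_ne_zero (g : GLK F) : (g : Mat F).det ≠ 0 := (Matrix.isUnits_det_units g).ne_zero

theorem ordDet_mul (g h : GLK F) : ordDet (g * h) = ordDet g + ordDet h := by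
  rw [ordDet, Units.val_mul, Matrix.det_mul, HahnSeries.order_mul (det_ne_zero g) (det_ne_zero h)]
  rfl

theorem ordDet_one : ordDet (1 : GLK F) = 0 := by simp [ordDet]

theorem ordDet_inv (g : GLK F) : ordDet g⁻¹ = -ordDet g := by
  have := ordDet_mul g g⁻¹
  rw [mul_inv_cancel, ordDet_one] at this
  omega

theorem addVal_det_eq_ordDet (g : GLK F) :
    HahnSeries.addVal ℤ F (g : Mat F).det = (ordDet g : WithTop ℤ) := by
  rw [HahnSeries.addVal_apply, ← HahnSeries.order_eq_orderTop_of_ne_zero (det_ne_zero g)]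
  rfl

theorem ordDet_glEmb (g : GLPoly F) : ordDet (glEmb g) = 0 := by
  have := addVal_det_glEmb g
  rwa [addVal_det_eq_ordDet, WithTop.coe_inj] at this

theorem ordDet_diagUnif : ordDet (diagUnif F) = 1 := by
  have := addVal_unif (F := F)
  rwa [← det_diagUnif, addVal_det_eq_ordDet, WithTop.coe_inj] at this

/-- The normalizer of M₂(O) has determinants of even valuation, so the parity of `ordDet g` depends
only on the vertex g M₂(O) g⁻¹. This is the two-colouring of the tree. -/
theorem even_ordDet_of_conj_eq {g h : GLK F} (H : conj g (stdOrder F) = conj h (stdOrder F)) :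
    Even (ordDet g + ordDet h) := by
  have h1 : conj (h⁻¹ * g) (stdOrder F) = stdOrder F := by
    rw [conj_mul, H, ← conj_mul, inv_mul_cancel, conj_one]
  obtain ⟨n, hn⟩ := addVal_det_even h1
  rw [addVal_det_eq_ordDet, WithTop.coe_inj, ordDet_mul, ordDet_inv] at hn
  exact ⟨n + ordDet h, by omega⟩

/-- Passing to a neighbor multiplies by `diagUnif`, of determinant valuation 1, and so changes the
colour. -/
theorem Neighbors.odd_ordDet {g h : GLK F}
    (H : Neighbors (InfTree.conj g (stdOrder F)) (InfTree.conj h (stdOrder F))) :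
    Odd (ordDet g + ordDet h) := by
  obtain ⟨k, h1, h2⟩ := H
  rw [← conj_mul] at h2
  obtain ⟨a, ha⟩ := even_ordDet_of_conj_eq h1
  obtain ⟨b, hb⟩ := even_ordDet_of_conj_eq h2
  rw [ordDet_mul, ordDet_diagUnif] at hb
  exact ⟨a + b - ordDet k - 1, by omega⟩

variable (F) in
/-- The embedding of `GL₂` of the ring of integers. -/
noncomputable def intEmb : GL (Fin 2) (PowerSeries F) →* GLK F :=
  Matrix.GeneralLinearGroup.map (algebraMap (PowerSeries F) (LaurentSeries F))

theorem conj_intEmb (k : GL (Fin 2) (PowerSeries F)) :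
    conj (intEmb F k) (stdOrder F) = stdOrder F := by
  have hmem : ∀ k, ((intEmb F k : GLK F) : Mat F) ∈ stdOrder F := fun k =>
    ⟨(k : Matrix (Fin 2) (Fin 2) (PowerSeries F)), rfl⟩
  have hle : ∀ k, conj (intEmb F k) (stdOrder F) ≤ stdOrder F := by
    rintro k x ⟨y, hy, rfl⟩
    change ((intEmb F k : GLK F) : Mat F) * y * (((intEmb F k)⁻¹ : GLK F) : Mat F) ∈ stdOrder F
    rw [← map_inv]
    exact mul_mem (mul_mem (hmem k) hy) (hmem k⁻¹)
  refine le_antisymm (hle k) ?_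
  have h2 := conj_mono (intEmb F k) (hle k⁻¹)
  rwa [← conj_mul, ← map_mul, mul_inv_cancel, map_one, conj_one] at h2

/-- The normalizer of `M₂(O)`, among matrices with a determinant of valuation zero, is `GL₂(O)`. -/
theorem exists_intEmb_eq {g : GLK F} (h : conj g (stdOrder F) = stdOrder F) (h0 : ordDet g = 0) :
    ∃ k, intEmb F k = g := by
  have key : ∀ g : GLK F, conj g (stdOrder F) = stdOrder F → ordDet g = 0 →
      ∃ K : Matrix (Fin 2) (Fin 2) (PowerSeries F),
        K.map (algebraMap (PowerSeries F) (LaurentSeries F)) = (g : Mat F) := by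
    intro g h h0
    suffices ∀ i j, ∃ p : PowerSeries F,
        algebraMap (PowerSeries F) (LaurentSeries F) p = (g : Mat F) i j by
      choose K hK using this
      exact ⟨Matrix.of K, by ext1 i j; exact hK i j⟩
    intro i j
    apply mem_range_algebraMap_of_order_nonneg
    by_cases hz : (g : Mat F) i j = 0
    · rw [hz, HahnSeries.order_zero]
    have hadj : (g : Mat F).det • (((g)⁻¹ : GLK F) : Mat F) = (g : Mat F).adjugate := by
      have : (((g)⁻¹ : GLK F) : Mat F) = (g : Mat F)⁻¹ := Matrix.coe_units_inv g
      rw [this, Matrix.inv_def, smul_smul, Ring.mul_inverse_cancel _ (Matrix.isUnits_det_units g),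
        one_smul]
    -- Each entry of g is, up to sign, an entry of its adjugate. So det g times the (i, b) entry of
    -- the integral matrix g E_{ja} g⁻¹ is ± g_{ij}², whence 2 ord(g_{ij}) ≥ ord(det g) = 0.
    obtain ⟨a, b, hab⟩ : ∃ a b, (g : Mat F).adjugate a b = (g : Mat F) i j ∨
        (g : Mat F).adjugate a b = -(g : Mat F) i j := by
      rw [Matrix.adjugate_fin_two]
      fin_cases i <;> fin_cases j
      · exact ⟨1, 1, by simp⟩
      · exact ⟨0, 1, by simp⟩
      · exact ⟨1, 0, by simp⟩
      · exact ⟨0, 0, by simp⟩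
    have hmem : (g : Mat F) * Matrix.single j a 1 * (((g)⁻¹ : GLK F) : Mat F) ∈ stdOrder F := by
      have : (g : Mat F) * Matrix.single j a 1 * (((g)⁻¹ : GLK F) : Mat F) ∈ conj g (stdOrder F) :=
        ⟨_, single_mem_stdOrder j a, rfl⟩
      rwa [h] at this
    rw [mem_stdOrder] at hmem
    obtain ⟨p, hp⟩ := hmem i b
    have hkey : (g : Mat F).det * algebraMap (PowerSeries F) (LaurentSeries F) p =
        (g : Mat F) i j * (g : Mat F).adjugate a b := by
      rw [hp, ← hadj]
      fin_cases j <;> fin_cases a <;>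
        simp [Matrix.mul_apply, Fin.sum_univ_two, Matrix.single] <;> ring
    have hsq : algebraMap (PowerSeries F) (LaurentSeries F) p ≠ 0 := by
      intro hp0
      rw [hp0, mul_zero] at hkey
      rcases hab with hab | hab <;> rw [hab] at hkey
      · exact mul_ne_zero hz hz hkey.symm
      · exact mul_ne_zero hz (neg_ne_zero.2 hz) hkey.symm
    have h1 := congrArg HahnSeries.order hkey
    have h2 : ((g : Mat F).adjugate a b).order = ((g : Mat F) i j).order := by
      rcases hab with hab | hab <;> rw [hab]
      rw [HahnSeries.order_neg]
    have hab0 : (g : Mat F).adjugate a b ≠ 0 := by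
      rcases hab with hab | hab <;> rw [hab]
      · exact hz
      · exact neg_ne_zero.2 hz
    rw [HahnSeries.order_mul (det_ne_zero g) hsq, HahnSeries.order_mul hz hab0, h2] at h1
    have h3 : 0 ≤ (algebraMap (PowerSeries F) (LaurentSeries F) p).order := by
      have := addVal_nonneg p
      rw [HahnSeries.addVal_apply, ← HahnSeries.order_eq_orderTop_of_ne_zero hsq] at this
      exact_mod_cast this
    have h4 : (g : Mat F).det.order = 0 := h0
    omega
  obtain ⟨K, hK⟩ := key g h h0
  obtain ⟨K', hK'⟩ := key g⁻¹ (by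
    conv_lhs => rw [← h]
    rw [← conj_mul, inv_mul_cancel, conj_one]) (by rw [ordDet_inv, h0, neg_zero])
  have hinj : Function.Injective fun M : Matrix (Fin 2) (Fin 2) (PowerSeries F) =>
      M.map (algebraMap (PowerSeries F) (LaurentSeries F)) :=
    Matrix.map_injective (FaithfulSMul.algebraMap_injective _ _)
  refine ⟨⟨K, K', hinj ?_, hinj ?_⟩, Units.ext hK⟩
  · change (K * K').map _ = (1 : Matrix (Fin 2) (Fin 2) (PowerSeries F)).map _
    rw [Matrix.map_mul, hK, hK', Units.mul_inv, Matrix.map_one _ (map_zero _) (map_one _)]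
  · change (K' * K).map _ = (1 : Matrix (Fin 2) (Fin 2) (PowerSeries F)).map _
    rw [Matrix.map_mul, hK, hK', Units.inv_mul, Matrix.map_one _ (map_zero _) (map_one _)]

/-- A scalar matrix whose entry is a power of the uniformizer. -/
noncomputable def scalarK (n : ℤ) : GLK F :=
  Matrix.GeneralLinearGroup.mkOfDetNeZero (HahnSeries.single n (1 : F) • (1 : Mat F)) (by simp)

theorem conj_scalarK (n : ℤ) (D : Subalgebra (PowerSeries F) (Mat F)) :
    conj (scalarK n) D = D := by
  ext x
  have h : ((scalarK n : GLK F) : Mat F) = HahnSeries.single n (1 : F) • (1 : Mat F) := rfl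
  have e : x * ((scalarK n : GLK F) : Mat F) = ((scalarK n : GLK F) : Mat F) * x := by
    rw [h]; simp
  rw [mem_conj, mul_assoc, e, Units.inv_mul_cancel_left]

theorem ordDet_scalarK (n : ℤ) : ordDet (scalarK n : GLK F) = 2 * n := by
  have h : ((scalarK n : GLK F) : Mat F) = HahnSeries.single n (1 : F) • (1 : Mat F) := rfl
  rw [ordDet, h, Matrix.det_smul, Matrix.det_one, mul_one, Fintype.card_fin, HahnSeries.single_pow,
    one_pow, HahnSeries.order_single one_ne_zero]
  simp

/-- The embedding of `GL₂(F)` in `GL₂(F[t])`. -/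
noncomputable def constEmb : GL (Fin 2) F →* GLPoly F :=
  Matrix.GeneralLinearGroup.map Polynomial.C

theorem polyEmb_C (c : F) : polyEmb F (Polynomial.C c) = HahnSeries.C c := by
  simp [polyEmb]

theorem polyEmb_X : polyEmb F Polynomial.X = HahnSeries.single (-1) 1 := by
  simp [polyEmb]

theorem coeff_polyEmb (p : Polynomial F) (n : ℕ) : (polyEmb F p).coeff (-(n : ℤ)) = p.coeff n := by
  induction p using Polynomial.induction_on' with
  | add p q hp hq => rw [map_add, HahnSeries.coeff_add, hp, hq, Polynomial.coeff_add]
  | monomial m c =>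
    rw [← Polynomial.C_mul_X_pow_eq_monomial, map_mul, map_pow, polyEmb_C, polyEmb_X,
      HahnSeries.single_pow, HahnSeries.C_apply, HahnSeries.single_mul_single, HahnSeries.coeff_single,
      Polynomial.coeff_C_mul_X_pow]
    simp

/-- Constants lie both in F[t] and in O, which is why GL₂(F) fixes the vertex of type 0. -/
theorem glEmb_constEmb (k : GL (Fin 2) F) :
    glEmb (constEmb k) = intEmb F (Matrix.GeneralLinearGroup.map PowerSeries.C k) := by
  apply Units.ext
  ext1 i j
  change polyEmb F (Polynomial.C (k i j)) =
    algebraMap (PowerSeries F) (LaurentSeries F) (PowerSeries.C (k i j))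
  rw [polyEmb_C, LaurentSeries.coe_algebraMap, HahnSeries.ofPowerSeries_C]

/-! ### The first two vertices of the standard ray -/

variable (F) in
/-- The vertex of type zero on the standard ray. -/
noncomputable abbrev vertexZero : (tree F).V := ballOrder 0 (-((0 : ℕ) : ℤ))

variable (F) in
/-- The vertex of type one on the standard ray. -/
noncomputable abbrev vertexOne : (tree F).V := ballOrder 0 (-((1 : ℕ) : ℤ))

theorem vertexZero_val : (vertexZero F).1 = stdOrder F := by
  change conj _ _ = _
  conv_rhs => rw [← conj_swapK]
  congr 2

variable (F) in
/-- The matrix `[[0, t], [1, 0]]`. -/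
noncomputable def rayK : GLK F :=
  Matrix.GeneralLinearGroup.mkOfDetNeZero !![0, HahnSeries.single (-1) 1; 1, 0]
    (by simp [Matrix.det_fin_two])

theorem vertexOne_val : (vertexOne F).1 = conj (rayK F) (stdOrder F) := by
  rfl

theorem ordDet_rayK : ordDet (rayK F) = -1 := by
  change (!![0, HahnSeries.single (-1) 1; 1, 0] : Mat F).det.order = -1
  rw [Matrix.det_fin_two_of, zero_mul, zero_sub, mul_one, HahnSeries.order_neg,
    HahnSeries.order_single one_ne_zero]

theorem smul_val (g : GLPoly F) (D : (tree F).V) : (g • D : (tree F).V).1 = conj (glEmb g) D.1 :=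
  rfl

/-- Polynomial units have valuation 0 at infinity, so GL₂(F[t]) preserves the colours, and the two
vertices have opposite ones. -/
theorem smul_vertexZero_ne (g h : GLPoly F) : g • vertexZero F ≠ h • vertexOne F := by
  intro H
  have h1 := congrArg Subtype.val H
  rw [smul_val, smul_val, vertexZero_val, vertexOne_val, ← conj_mul] at h1
  obtain ⟨n, hn⟩ := even_ordDet_of_conj_eq h1
  rw [ordDet_mul, ordDet_glEmb, ordDet_glEmb, ordDet_rayK] at hn
  omega

theorem not_neighbors_vertexOne (g h : GLPoly F) :
    ¬ Neighbors (g • vertexOne F : (tree F).V).1 (h • vertexOne F : (tree F).V).1 := by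
  intro H
  rw [smul_val, smul_val, vertexOne_val, ← conj_mul, ← conj_mul] at H
  obtain ⟨n, hn⟩ := H.odd_ordDet
  rw [ordDet_mul, ordDet_mul, ordDet_glEmb, ordDet_glEmb, ordDet_rayK] at hn
  omega

theorem constEmb_smul_vertexZero (k : GL (Fin 2) F) :
    constEmb k • vertexZero F = vertexZero F := by
  apply Subtype.ext
  rw [smul_val, vertexZero_val, glEmb_constEmb, conj_intEmb]

/-- The stabilizer of the first vertex. -/
theorem exists_eq_constEmb {g : GLPoly F} (h : g • vertexZero F = vertexZero F) :
    ∃ k, g = constEmb k := by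
  have h1 := congrArg Subtype.val h
  rw [smul_val, vertexZero_val] at h1
  obtain ⟨k, hk⟩ := exists_intEmb_eq h1 (ordDet_glEmb g)
  refine ⟨Matrix.GeneralLinearGroup.map Polynomial.constantCoeff g, ?_⟩
  apply Units.ext
  ext1 i j
  change g i j = Polynomial.C (Polynomial.constantCoeff (g i j))
  ext n
  rw [Polynomial.coeff_C]
  split_ifs with hn
  · rw [hn, Polynomial.constantCoeff_apply]
  -- The coefficient of tⁿ is that of the power -n of the uniformizer, which vanishes for n > 0 in
  -- an integral entry: F[t] ∩ O = F.
  · rw [← coeff_polyEmb]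
    have : polyEmb F (g i j) = algebraMap (PowerSeries F) (LaurentSeries F) (k i j) :=
      congrArg (fun M : GLK F => M i j) hk.symm
    exact mem_range_algebraMap_iff.1 ⟨_, this.symm⟩ _ (by omega)

/-- Up to the scalar t, which acts trivially, `rayK` is `swapK * diagUnif`; this is the shape that
`Neighbors` asks for. -/
theorem conj_rayK : conj (rayK F) (stdOrder F) =
    conj (swapK F) (conj (diagUnif F) (stdOrder F)) := by
  have e : rayK F = scalarK (-1) * (swapK F * diagUnif F) := by
    apply Units.ext
    rw [Units.val_mul, Units.val_mul]
    change !![0, HahnSeries.single (-1) 1; 1, 0] = HahnSeries.single (-1) (1 : F) • (1 : Mat F) *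
      (!![0, 1; 1, 0] * !![unif F, 0; 0, 1])
    ext1 i j
    fin_cases i <;> fin_cases j <;> simp [HahnSeries.single_mul_single]
  rw [e, conj_mul, conj_scalarK, conj_mul]

theorem neighbors_vertexZero_vertexOne : Neighbors (vertexZero F).1 (vertexOne F).1 := by
  rw [vertexZero_val, vertexOne_val]
  exact ⟨swapK F, conj_swapK.symm, conj_rayK⟩

/-- The neighbors of the first vertex. -/
theorem Neighbors.exists_eq_constEmb_smul {E : (tree F).V} (h : Neighbors (vertexZero F).1 E.1) :
    ∃ k : GL (Fin 2) F, E = constEmb k • vertexOne F := by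
  rw [vertexZero_val] at h
  obtain ⟨g, h1, h2⟩ := h
  obtain ⟨n, hn⟩ := addVal_det_even h1.symm
  rw [addVal_det_eq_ordDet, WithTop.coe_inj] at hn
  -- The valuation of det g is 2n, so a scalar brings it to 0 without changing the orders, and g
  -- becomes an element of GL₂(O).
  obtain ⟨K, hK⟩ := exists_intEmb_eq (g := scalarK (-n) * g) (by rw [conj_mul, conj_scalarK, ← h1])
    (by rw [ordDet_mul, ordDet_scalarK, hn]; ring)
  have hE : E.1 = InfTree.conj (intEmb F K) (InfTree.conj (diagUnif F) (stdOrder F)) := by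
    rw [hK, conj_mul, conj_scalarK, h2]
  -- the reduction of `K`
  set κ := Matrix.GeneralLinearGroup.map PowerSeries.constantCoeff K with hκ
  set L := (Matrix.GeneralLinearGroup.map PowerSeries.C κ)⁻¹ * K with hL
  have hL1 : Matrix.GeneralLinearGroup.map PowerSeries.constantCoeff L = 1 := by
    have : Matrix.GeneralLinearGroup.map PowerSeries.constantCoeff
        (Matrix.GeneralLinearGroup.map PowerSeries.C κ) = κ := by
      apply Units.ext
      ext1 i j
      exact PowerSeries.constantCoeff_C _
    rw [hL, map_mul, map_inv, this, ← hκ, inv_mul_cancel]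
  obtain ⟨q, hq⟩ : PowerSeries.X ∣ L 0 1 := by
    rw [PowerSeries.X_dvd_iff]
    exact congrArg (fun M : GL (Fin 2) F => M 0 1) hL1
  have hLdet := Matrix.isUnits_det_units L
  rw [Matrix.det_fin_two] at hLdet
  -- L is the identity modulo the uniformizer, so its upper right entry is divisible by it. Hence L'
  -- = diag(π, 1)⁻¹ L diag(π, 1) is integral, L fixes the neighbor given by diag(π, 1), and only the
  -- residue κ of K matters.
  let L' : GL (Fin 2) (PowerSeries F) :=
    Matrix.GeneralLinearGroup.mk'' !![L 0 0, q; PowerSeries.X * L 1 0, L 1 1] (by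
      rw [Matrix.det_fin_two_of]
      convert hLdet using 2
      rw [hq]; ring)
  have hLL : intEmb F L * diagUnif F = diagUnif F * intEmb F L' := by
    apply Units.ext
    rw [Units.val_mul, Units.val_mul]
    change ((L : Matrix _ _ _).map (algebraMap (PowerSeries F) (LaurentSeries F))) *
        !![unif F, 0; 0, 1] = !![unif F, 0; 0, 1] *
      ((!![L 0 0, q; PowerSeries.X * L 1 0, L 1 1] : Matrix _ _ _).map
        (algebraMap (PowerSeries F) (LaurentSeries F)))
    ext1 i j
    fin_cases i <;> fin_cases j <;> simp [Matrix.mul_apply, Fin.sum_univ_two, hq, mul_comm]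
  have hKL : intEmb F K = glEmb (constEmb κ) * intEmb F L := by
    rw [glEmb_constEmb, ← map_mul, hL, mul_inv_cancel_left]
  let w : GL (Fin 2) F := Matrix.GeneralLinearGroup.mkOfDetNeZero !![0, 1; 1, 0] (by simp)
  have hw : glEmb (constEmb w) = swapK F := by
    apply Units.ext
    change ((!![0, 1; 1, 0] : Matrix (Fin 2) (Fin 2) F).map Polynomial.C).map (polyEmb F) =
      !![0, 1; 1, 0]
    ext1 i j
    fin_cases i <;> fin_cases j <;> simp
  have hww : swapK F * swapK F = 1 := by
    apply Units.ext
    rw [Units.val_mul]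
    change (!![0, 1; 1, 0] * !![0, 1; 1, 0] : Mat F) = 1
    rw [Matrix.mul_fin_two, Matrix.one_fin_two]
    simp
  refine ⟨κ * w, Subtype.ext ?_⟩
  rw [hE, smul_val, vertexOne_val, conj_rayK, map_mul, map_mul, hw, conj_mul _ (swapK F),
    ← conj_mul (swapK F) (swapK F), hww, conj_one, hKL, ← conj_mul, mul_assoc, hLL, conj_mul,
    conj_mul (diagUnif F), conj_intEmb]

/-- The unipotent matrices `[[1, x + y t], [0, 1]]`. -/
noncomputable def unip (x y : F) : GLPoly F :=
  Matrix.GeneralLinearGroup.upperRightHom (Polynomial.C x + Polynomial.C y * Polynomial.X)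

theorem unip_mul (x y x' y' : F) : unip x y * unip x' y' = unip (x + x') (y + y') := by
  rw [unip, unip, ← AddChar.map_add_eq_mul, unip]
  congr 1
  simp only [map_add]
  ring

theorem unip_zero_right (x : F) :
    unip x 0 = constEmb (Matrix.GeneralLinearGroup.upperRightHom x) := by
  apply Units.ext
  change !![1, Polynomial.C x + Polynomial.C 0 * Polynomial.X; 0, 1] =
    (!![1, x; 0, 1] : Matrix _ _ _).map Polynomial.C
  ext1 i j
  fin_cases i <;> fin_cases j <;> simp

/-- Conjugation by `rayK` moves the entry x + yt to the lower left corner and divides it by t, which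
leaves the integral element xt⁻¹ + y. -/
theorem unip_smul_vertexOne (x y : F) : unip x y • vertexOne F = vertexOne F := by
  apply Subtype.ext
  rw [smul_val, vertexOne_val]
  have e : glEmb (unip x y) * rayK F = rayK F * intEmb F
      (Matrix.GeneralLinearGroup.mk'' !![1, 0; PowerSeries.C x * PowerSeries.X + PowerSeries.C y, 1]
        (by simp)) := by
    apply Units.ext
    rw [Units.val_mul, Units.val_mul]
    change (!![1, Polynomial.C x + Polynomial.C y * Polynomial.X; 0, 1] : Matrix _ _ _).map
        (polyEmb F) * !![0, HahnSeries.single (-1) 1; 1, 0] = !![0, HahnSeries.single (-1) 1; 1, 0] *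
      (!![1, 0; PowerSeries.C x * PowerSeries.X + PowerSeries.C y, 1] : Matrix _ _ _).map
        (algebraMap (PowerSeries F) (LaurentSeries F))
    ext1 i j
    fin_cases i <;> fin_cases j <;>
      simp [Matrix.mul_apply, Fin.sum_univ_two, polyEmb_C, polyEmb_X, mul_add, HahnSeries.C_apply, HahnSeries.single_mul_single]
  rw [← conj_mul, e, conj_mul, conj_intEmb]

/-- The stabilizer of the second vertex, up to a diagonal part. -/
theorem eq_of_smul_vertexOne {g : GLPoly F} (h : g • vertexOne F = vertexOne F) :
    (∃ a, g 0 0 = Polynomial.C a) ∧ (∃ d, g 1 1 = Polynomial.C d) ∧ g 1 0 = 0 ∧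
      ∃ x y, g 0 1 = Polynomial.C x + Polynomial.C y * Polynomial.X := by
  have h1 := congrArg Subtype.val h
  rw [smul_val, vertexOne_val] at h1
  obtain ⟨k, hk⟩ := exists_intEmb_eq (g := (rayK F)⁻¹ * (glEmb g * rayK F))
    (by rw [conj_mul, conj_mul, h1, ← conj_mul, inv_mul_cancel, conj_one])
    (by rw [ordDet_mul, ordDet_mul, ordDet_inv, ordDet_glEmb]; ring)
  have hm : glEmb g * rayK F = rayK F * intEmb F k := by rw [hk, mul_inv_cancel_left]
  have hm' : (g.1.map (polyEmb F)) * !![0, HahnSeries.single (-1) 1; 1, 0] =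
      !![0, HahnSeries.single (-1) 1; 1, 0] *
        k.1.map (algebraMap (PowerSeries F) (LaurentSeries F)) :=
    congrArg Units.val hm
  have hint : ∀ i j, ∀ n < 0, (HahnSeries.ofPowerSeries ℤ F (k i j)).coeff n = 0 :=
    fun i j => mem_range_algebraMap_iff.1 ⟨k i j, by rw [LaurentSeries.coe_algebraMap]⟩
  -- The entries give g₀₁ = t k₁₀, t g₀₀ = t k₁₁, g₁₁ = k₀₀ and t g₁₀ = k₀₁ with k integral. So g₀₀
  -- and g₁₁ have degree at most 0, g₀₁ has degree at most 1, and g₁₀ vanishes.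
  have h00 := congrFun (congrFun hm' 0) 0
  have h01 := congrFun (congrFun hm' 0) 1
  have h10 := congrFun (congrFun hm' 1) 0
  have h11 := congrFun (congrFun hm' 1) 1
  simp only [Matrix.mul_apply, Fin.sum_univ_two, Matrix.map_apply, Matrix.of_apply,
    Matrix.cons_val_zero, Matrix.cons_val_one, Matrix.cons_val_fin_one, mul_zero, mul_one,
    zero_mul, one_mul, zero_add, add_zero, LaurentSeries.coe_algebraMap] at h00 h01 h10 h11
  refine ⟨⟨(g 0 0).coeff 0, ?_⟩, ⟨(g 1 1).coeff 0, ?_⟩, ?_, (g 0 1).coeff 0, (g 0 1).coeff 1, ?_⟩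
  · ext n
    rw [Polynomial.coeff_C]
    split_ifs with hn
    · rw [hn]
    · have := congrArg (fun x => HahnSeries.coeff x (-(n : ℤ) - 1)) h01
      simp only [HahnSeries.coeff_mul_single, HahnSeries.coeff_single_mul, sub_neg_eq_add,
        sub_add_cancel, mul_one, one_mul, coeff_polyEmb] at this
      rw [this, hint _ _ _ (by omega)]
  · ext n
    rw [Polynomial.coeff_C]
    split_ifs with hn
    · rw [hn]
    · rw [← coeff_polyEmb, h10, hint _ _ _ (by omega)]
  · ext n
    have := congrArg (fun x => HahnSeries.coeff x (-(n : ℤ) - 1)) h11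
    simp only [HahnSeries.coeff_mul_single, sub_neg_eq_add, sub_add_cancel, mul_one,
      coeff_polyEmb] at this
    rw [this, hint _ _ _ (by omega), Polynomial.coeff_zero]
  · ext n
    rw [Polynomial.coeff_add, Polynomial.coeff_C, Polynomial.coeff_C_mul_X]
    by_cases hn : n = 0
    · simp [hn]
    by_cases hn' : n = 1
    · simp [hn']
    · rw [if_neg hn, if_neg hn', add_zero, ← coeff_polyEmb, h00, HahnSeries.coeff_single_mul,
        hint _ _ _ (by omega), mul_zero]

end InfTree

namespace InfTree

open Matrix QuadraticAlgebra

/-! ### Matrices over a quadratic algebra over the field of two elements -/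

theorem det_glPoly_zmod_two (g : GLPoly (ZMod 2)) : g.1.det = 1 := by
  obtain ⟨c, hc, hc'⟩ := Polynomial.isUnit_iff.mp (Matrix.isUnits_det_units g)
  rw [← hc']
  have : ∀ c : ZMod 2, c ≠ 0 → c = 1 := by decide
  rw [this c hc.ne_zero, Polynomial.C_1]

theorem exists_eq_unip {g : GLPoly (ZMod 2)} (h : g • vertexOne (ZMod 2) = vertexOne (ZMod 2)) :
    ∃ x y, g = unip x y := by
  obtain ⟨⟨a, ha⟩, ⟨d, hd⟩, hc, x, y, hb⟩ := eq_of_smul_vertexOne h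
  have hdet := det_glPoly_zmod_two g
  rw [Matrix.det_fin_two, hc, mul_zero, sub_zero, ha, hd, ← Polynomial.C_mul] at hdet
  have had : a * d = 1 := Polynomial.C_injective (hdet.trans Polynomial.C_1.symm)
  have h2 : ∀ x y : ZMod 2, x * y = 1 → x = 1 ∧ y = 1 := by decide
  obtain ⟨rfl, rfl⟩ := h2 _ _ had
  refine ⟨x, y, Units.ext ?_⟩
  change g.1 = !![1, Polynomial.C x + Polynomial.C y * Polynomial.X; 0, 1]
  rw [Matrix.eta_fin_two g.1, ha, hb, hc, hd, Polynomial.C_1]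

variable {a b : ZMod 2}

/-- The imaginary part of a matrix. -/
def imM (M : Matrix (Fin 2) (Fin 2) (QuadraticAlgebra (ZMod 2) a b)) :
    Matrix (Fin 2) (Fin 2) (ZMod 2) := M.map QuadraticAlgebra.im

variable (a b) in
/-- The embedding of `GL₂` of the field of two elements. -/
def constQ : GL (Fin 2) (ZMod 2) →* GL (Fin 2) (QuadraticAlgebra (ZMod 2) a b) :=
  Matrix.GeneralLinearGroup.map (algebraMap (ZMod 2) (QuadraticAlgebra (ZMod 2) a b))

/-- Taking imaginary parts is F₂-linear. Consequently the rank of the imaginary part is constant on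
double cosets of GL₂(F₂). -/
theorem imM_constQ_mul_mul (k k' : GL (Fin 2) (ZMod 2))
    (M : Matrix (Fin 2) (Fin 2) (QuadraticAlgebra (ZMod 2) a b)) :
    imM ((constQ a b k).1 * M * (constQ a b k').1) = k.1 * imM M * k'.1 := by
  change imM (k.1.map (algebraMap (ZMod 2) (QuadraticAlgebra (ZMod 2) a b)) * M *
    k'.1.map (algebraMap (ZMod 2) (QuadraticAlgebra (ZMod 2) a b))) = _
  ext i j
  simp [imM, Matrix.mul_apply, Fin.sum_univ_two]

theorem imM_constQ (k : GL (Fin 2) (ZMod 2)) : imM (constQ a b k).1 = 0 := by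
  ext i j
  rfl

/-- A matrix of determinant one without imaginary part has entries in the ground field. -/
theorem exists_constQ_eq {Q : GL (Fin 2) (QuadraticAlgebra (ZMod 2) a b)} (hQ : imM Q.1 = 0) :
    ∃ k, Q = constQ a b k := by
  have hre : Q.1 = (Q.1.map QuadraticAlgebra.re).map
      (algebraMap (ZMod 2) (QuadraticAlgebra (ZMod 2) a b)) := by
    ext i j
    · rfl
    · exact congrFun (congrFun hQ i) j
  have hu : IsUnit (Q.1.map QuadraticAlgebra.re).det := by
    have h1 : IsUnit Q.1.det := Matrix.isUnits_det_units Q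
    rw [hre, ← RingHom.mapMatrix_apply, ← RingHom.map_det] at h1
    rw [isUnit_iff_ne_zero]
    intro h0
    rw [h0, map_zero] at h1
    exact not_isUnit_zero h1
  exact ⟨Matrix.GeneralLinearGroup.mk'' _ hu, Units.ext hre⟩

/-- The matrix `[[1, ω], [0, 1]]`. -/
def unipOmega : GL (Fin 2) (QuadraticAlgebra (ZMod 2) a b) :=
  Matrix.GeneralLinearGroup.upperRightHom ω

theorem imM_unipOmega : imM (unipOmega (a := a) (b := b)).1 = !![0, 1; 0, 0] := by
  ext i j
  change ((!![1, ω; 0, 1] : Matrix _ _ (QuadraticAlgebra (ZMod 2) a b)) i j).im = _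
  fin_cases i <;> fin_cases j <;> simp

/-- This bounds K ∩ uKu⁻¹ for u = `unipOmega`. The imaginary part of the lower right entry of ku =
uk' is k₁₀ = 0, and over F₂ an invertible triangular matrix is unipotent. -/
theorem exists_eq_upperRightHom_of_unipOmega_conj {k k' : GL (Fin 2) (ZMod 2)}
    (h : constQ a b k * unipOmega = unipOmega * constQ a b k') :
    ∃ x, k = Matrix.GeneralLinearGroup.upperRightHom x := by
  have h1 : (k.1.map (algebraMap (ZMod 2) (QuadraticAlgebra (ZMod 2) a b))) * !![1, ω; 0, 1] =
      !![1, ω; 0, 1] * (k'.1.map (algebraMap (ZMod 2) (QuadraticAlgebra (ZMod 2) a b))) :=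
    congrArg Units.val h
  have h00 := congrArg im (congrFun (congrFun h1 0) 0)
  have h01 := congrArg im (congrFun (congrFun h1 0) 1)
  have h10 := congrArg re (congrFun (congrFun h1 1) 0)
  have h11 := congrArg im (congrFun (congrFun h1 1) 1)
  simp [Matrix.mul_apply, Fin.sum_univ_two] at h00 h01 h10 h11
  have hk : k.1.det ≠ 0 := (Matrix.isUnits_det_units k).ne_zero
  rw [Matrix.det_fin_two, h11, mul_zero, sub_zero] at hk
  have h2 : ∀ x y : ZMod 2, x * y ≠ 0 → x = 1 ∧ y = 1 := by decide
  obtain ⟨ha, hd⟩ := h2 _ _ hk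
  refine ⟨k 0 1, Units.ext ?_⟩
  change k.1 = !![1, k.1 0 1; 0, 1]
  conv_lhs => rw [Matrix.eta_fin_two k.1, ha, hd, h11]

/-- Row and column operations bring any matrix of rank one to this form. The enumeration runs over
matrices of determinant 1, which are then turned into units. -/
theorem exists_mul_mul_eq_single {A : Matrix (Fin 2) (Fin 2) (ZMod 2)} (h0 : A ≠ 0)
    (hdet : A.det = 0) : ∃ k k' : GL (Fin 2) (ZMod 2), k.1 * A * k'.1 = !![0, 1; 0, 0] := by
  have key : ∀ A : Matrix (Fin 2) (Fin 2) (ZMod 2), A ≠ 0 → A.det = 0 →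
      ∃ k k' : Matrix (Fin 2) (Fin 2) (ZMod 2), k.det = 1 ∧ k'.det = 1 ∧
        k * A * k' = !![0, 1; 0, 0] := by decide
  obtain ⟨k, k', hk, hk', h⟩ := key A h0 hdet
  exact ⟨Matrix.GeneralLinearGroup.mk'' k (by rw [hk]; exact isUnit_one),
    Matrix.GeneralLinearGroup.mk'' k' (by rw [hk']; exact isUnit_one), h⟩

/-- The double coset of `unipOmega`. -/
theorem exists_eq_constQ_mul_unipOmega_mul {Q : GL (Fin 2) (QuadraticAlgebra (ZMod 2) a b)}
    (hQ : Q.1.det = 1) (h0 : imM Q.1 ≠ 0) (hdet : (imM Q.1).det = 0) :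
    ∃ k k', Q = constQ a b k * unipOmega * constQ a b k' := by
  obtain ⟨k, k', h⟩ := exists_mul_mul_eq_single h0 hdet
  have hdet1 : ∀ k, (constQ a b k).1.det = 1 := by
    intro k
    have h1 : k.1.det = 1 := by
      have : ∀ c : ZMod 2, c ≠ 0 → c = 1 := by decide
      exact this _ (Matrix.isUnits_det_units k).ne_zero
    change (k.1.map (algebraMap (ZMod 2) (QuadraticAlgebra (ZMod 2) a b))).det = 1
    rw [← RingHom.mapMatrix_apply, ← RingHom.map_det, h1, map_one]
  rw [← imM_constQ_mul_mul (a := a) (b := b)] at h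
  set P := constQ a b k * Q * constQ a b k' with hP
  have hPdet : P.1.det = 1 := by
    rw [hP, Units.val_mul, Units.val_mul, Matrix.det_mul, Matrix.det_mul, hdet1, hdet1, hQ]; simp
  have hPim : ∀ i j, (P.1 i j).im = (!![0, 1; 0, 0] : Matrix _ _ (ZMod 2)) i j := fun i j =>
    congrFun (congrFun h i) j
  have e : ∀ i j, P.1 i j = ⟨(P.1 i j).re, (!![0, 1; 0, 0] : Matrix _ _ (ZMod 2)) i j⟩ :=
    fun i j => QuadraticAlgebra.ext rfl (hPim i j)
  rw [Matrix.det_fin_two, e 0 0, e 0 1, e 1 0, e 1 1] at hPdet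
  -- With imaginary part E₀₁ the determinant of P is p₀₀p₁₁ - p₁₀(p₀₁ + ω), with pᵢⱼ the real parts.
  -- Being 1, it forces p₁₀ = 0 and p₀₀p₁₁ = 1.
  have h1 := congrArg re hPdet
  have h2 := congrArg im hPdet
  simp at h1 h2
  rw [h2, mul_zero, sub_zero] at h1
  have h3 : ∀ x y : ZMod 2, x * y = 1 → x = 1 ∧ y = 1 := by decide
  obtain ⟨hx, hy⟩ := h3 _ _ h1
  have hPe : P = constQ a b (Matrix.GeneralLinearGroup.upperRightHom (P.1 0 1).re) * unipOmega := by
    apply Units.ext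
    rw [Units.val_mul]
    change P.1 = (!![1, (P.1 0 1).re; 0, 1] : Matrix _ _ (ZMod 2)).map
      (algebraMap (ZMod 2) (QuadraticAlgebra (ZMod 2) a b)) * !![1, ω; 0, 1]
    ext i j <;> fin_cases i <;> fin_cases j <;>
      simp [Matrix.mul_apply, Fin.sum_univ_two, hx, hy, h2, hPim]
  refine ⟨k⁻¹ * Matrix.GeneralLinearGroup.upperRightHom (P.1 0 1).re, k'⁻¹, ?_⟩
  rw [map_mul, mul_assoc (constQ a b k⁻¹), ← hPe, hP, map_inv, map_inv]
  group

/-! ### Reduction modulo a quadratic polynomial -/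

variable (a b) in
/-- The evaluation at `ω`. -/
noncomputable def red : Polynomial (ZMod 2) →+* QuadraticAlgebra (ZMod 2) a b :=
  (Polynomial.aeval (ω : QuadraticAlgebra (ZMod 2) a b)).toRingHom

theorem red_C (x : ZMod 2) :
    red a b (Polynomial.C x) = algebraMap (ZMod 2) (QuadraticAlgebra (ZMod 2) a b) x :=
  Polynomial.aeval_C _ x

theorem red_X : red a b Polynomial.X = ω := Polynomial.aeval_X _

theorem red_linear (x y : ZMod 2) :
    red a b (Polynomial.C x + Polynomial.C y * Polynomial.X) = ⟨x, y⟩ := by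
  rw [map_add, map_mul, red_C, red_C, red_X]
  ext <;> simp

variable (a b) in
/-- The quadratic polynomial with root `ω`. -/
noncomputable def quadPoly : Polynomial (ZMod 2) :=
  Polynomial.X ^ 2 + (Polynomial.C b * Polynomial.X + Polynomial.C a)

theorem red_quadPoly : red a b (quadPoly a b) = 0 := by
  rw [quadPoly, map_add, map_pow, add_comm (_ * _), red_linear, red_X, pow_two,
    omega_mul_omega_eq_mk]
  have h2 : ∀ c : ZMod 2, c + c = 0 := by decide
  ext <;> simp [h2]

/-- The remainder of p modulo `quadPoly a b` is some x + yt, whose value x + yω vanishes only for x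
= y = 0. -/
theorem red_eq_zero_iff (p : Polynomial (ZMod 2)) : red a b p = 0 ↔ quadPoly a b ∣ p := by
  have hdeg : (Polynomial.C b * Polynomial.X + Polynomial.C a).degree < ((2 : ℕ) : WithBot ℕ) :=
    lt_of_le_of_lt Polynomial.degree_linear_le (by norm_num)
  have hmon : (quadPoly a b).Monic := Polynomial.monic_X_pow_add hdeg
  constructor
  · intro h
    rw [← Polynomial.modByMonic_eq_zero_iff_dvd hmon]
    have h1 := Polynomial.degree_modByMonic_lt p hmon
    rw [quadPoly, Polynomial.degree_add_eq_left_of_degree_lt (by rwa [Polynomial.degree_X_pow]),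
      Polynomial.degree_X_pow] at h1
    have h2 := Polynomial.eq_X_add_C_of_natDegree_le_one (p := p %ₘ quadPoly a b)
      (Polynomial.natDegree_le_iff_coeff_eq_zero.2 fun n hn =>
        Polynomial.coeff_eq_zero_of_degree_lt (h1.trans_le (by exact_mod_cast hn)))
    have h3 : red a b (p %ₘ quadPoly a b) = 0 := by
      rw [← h]
      conv_rhs => rw [← Polynomial.modByMonic_add_div p (quadPoly a b)]
      rw [map_add, map_mul, red_quadPoly, zero_mul, add_zero]
    rw [h2, add_comm, red_linear] at h3
    have h4 := congrArg re h3
    have h5 := congrArg im h3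
    simp only [re_zero, im_zero] at h4 h5
    rw [h2, h4, h5]
    simp
  · rintro ⟨q, rfl⟩
    rw [map_mul, red_quadPoly, zero_mul]

variable (a b) in
/-- The reduction of matrices. -/
noncomputable def redG : GLPoly (ZMod 2) →* GL (Fin 2) (QuadraticAlgebra (ZMod 2) a b) :=
  Matrix.GeneralLinearGroup.map (red a b)

theorem mem_Gam_iff {g : GLPoly (ZMod 2)} : g ∈ Gam (quadPoly a b) ↔ redG a b g = 1 := by
  have h1 : ∀ p q, Ideal.Quotient.mk (Ideal.span {quadPoly a b}) p =
      Ideal.Quotient.mk (Ideal.span {quadPoly a b}) q ↔ red a b p = red a b q := by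
    intro p q
    rw [Ideal.Quotient.mk_eq_mk_iff_sub_mem, Ideal.mem_span_singleton, ← red_eq_zero_iff, map_sub,
      sub_eq_zero]
  rw [Gam, MonoidHom.mem_ker]
  have h2 : ∀ {S : Type} [CommRing S] (φ : Polynomial (ZMod 2) →+* S),
      Matrix.GeneralLinearGroup.map (n := Fin 2) φ g = 1 ↔
        ∀ i j, φ (g i j) = φ ((1 : Matrix (Fin 2) (Fin 2) (Polynomial (ZMod 2))) i j) := by
    intro S _ φ
    rw [Units.ext_iff, ← Matrix.ext_iff]
    refine forall_congr' fun i => forall_congr' fun j => ?_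
    have : φ ((1 : Matrix (Fin 2) (Fin 2) (Polynomial (ZMod 2))) i j) = (1 : Matrix _ _ S) i j := by
      rw [Matrix.one_apply, Matrix.one_apply, apply_ite φ, map_one, map_zero]
    rw [this]
    rfl
  rw [redG, h2, h2]
  exact forall_congr' fun i => forall_congr' fun j => h1 _ _

theorem redG_constEmb (k : GL (Fin 2) (ZMod 2)) : redG a b (constEmb k) = constQ a b k := by
  apply Units.ext
  ext1 i j
  exact red_C (k i j)

theorem redG_unip (x y : ZMod 2) :
    redG a b (unip x y) = Matrix.GeneralLinearGroup.upperRightHom ⟨x, y⟩ := by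
  apply Units.ext
  change (!![1, Polynomial.C x + Polynomial.C y * Polynomial.X; 0, 1] : Matrix _ _ _).map
    (red a b) = !![1, ⟨x, y⟩; 0, 1]
  ext1 i j
  rw [Matrix.map_apply]
  fin_cases i <;> fin_cases j
  · exact map_one _
  · exact red_linear x y
  · exact map_zero _
  · exact map_one _

theorem det_redG (g : GLPoly (ZMod 2)) : (redG a b g).1.det = 1 := by
  change (g.1.map (red a b)).det = 1
  rw [← RingHom.mapMatrix_apply, ← RingHom.map_det, det_glPoly_zmod_two, map_one]

instance : Fintype (QuadraticAlgebra (ZMod 2) a b) :=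
  Fintype.ofEquiv (ZMod 2 × ZMod 2) (QuadraticAlgebra.equivProd a b).symm

/-- The right-hand side says that (p, r) is the first column of a product lower · upper · lower of
elementary matrices. A finite ring has stable rank one: some z = r - xp is a unit, and then y = (p -
1)/z. -/
theorem exists_elementary : ∀ (a b : ZMod 2) (p r : QuadraticAlgebra (ZMod 2) a b),
    (∃ q s, p * s - q * r = 1) → ∃ x y z, p = 1 + y * z ∧ r = x * p + z := by
  decide +kernel

/-- The reduction of `SL₂` is surjective. -/
theorem exists_redG_eq {M : Matrix (Fin 2) (Fin 2) (QuadraticAlgebra (ZMod 2) a b)}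
    (hM : M.det = 1) : ∃ g, (redG a b g).1 = M := by
  have hsurj : ∀ x : QuadraticAlgebra (ZMod 2) a b, ∃ p, red a b p = x := fun x =>
    ⟨_, red_linear x.re x.im⟩
  rw [Matrix.det_fin_two] at hM
  obtain ⟨x, y, z, h1, h2⟩ := exists_elementary a b (M 0 0) (M 1 0) ⟨M 0 1, M 1 1, hM⟩
  obtain ⟨x, rfl⟩ := hsurj x
  obtain ⟨y, rfl⟩ := hsurj y
  obtain ⟨z, rfl⟩ := hsurj z
  -- The product A of the three elementary matrices has the first column of M, so A⁻¹M is upper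
  -- unipotent; this is its upper right entry.
  obtain ⟨w, hw⟩ := hsurj ((red a b x * red a b y + 1) * M 0 1 - red a b y * M 1 1)
  let lo : Polynomial (ZMod 2) → GLPoly (ZMod 2) := fun p =>
    Matrix.GeneralLinearGroup.mk'' !![1, 0; p, 1] (by simp)
  let up : Polynomial (ZMod 2) → GLPoly (ZMod 2) := fun p =>
    Matrix.GeneralLinearGroup.mk'' !![1, p; 0, 1] (by simp)
  refine ⟨lo x * up y * lo z * up w, ?_⟩
  have hlo : ∀ p, (redG a b (lo p)).1 = !![1, 0; red a b p, 1] := by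
    intro p
    change (!![1, 0; p, 1] : Matrix _ _ _).map (red a b) = _
    ext1 i j
    fin_cases i <;> fin_cases j <;> simp
  have hup : ∀ p, (redG a b (up p)).1 = !![1, red a b p; 0, 1] := by
    intro p
    change (!![1, p; 0, 1] : Matrix _ _ _).map (red a b) = _
    ext1 i j
    fin_cases i <;> fin_cases j <;> simp
  rw [map_mul, map_mul, map_mul, Units.val_mul, Units.val_mul, Units.val_mul, hlo, hup, hlo, hup, hw,
    Matrix.mul_fin_two, Matrix.mul_fin_two, Matrix.mul_fin_two]
  conv_rhs => rw [Matrix.eta_fin_two M]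
  rw [h1] at h2 hM
  rw [h2] at hM
  ext1 i j
  fin_cases i <;> fin_cases j <;> simp only [Fin.zero_eta, Fin.mk_one, Matrix.of_apply,
    Matrix.cons_val_zero, Matrix.cons_val_one, Matrix.cons_val_fin_one]
  · rw [h1]; ring
  · linear_combination (-red a b y) * hM
  · rw [h2]; ring
  · linear_combination (-(red a b x * red a b y + 1)) * hM

end InfTree

namespace InfTree

open Matrix QuadraticAlgebra

variable {a b : ZMod 2}

/-! ### The quotient graph -/

variable (a b) in
/-- The image of a vertex in the quotient. -/
noncomputable def quotV (D : (tree (ZMod 2)).V) : (quotGraph (quadPoly a b)).V := Quotient.mk _ D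

variable (a b) in
/-- The image of an edge in the quotient. -/
noncomputable def quotA (E : (tree (ZMod 2)).A) : (quotGraph (quadPoly a b)).A := Quotient.mk _ E

theorem quotV_smul_eq {g h : GLPoly (ZMod 2)} (hgh : redG a b g = redG a b h)
    (D : (tree (ZMod 2)).V) : quotV a b (g • D) = quotV a b (h • D) :=
  Quotient.sound ⟨⟨g * h⁻¹, mem_Gam_iff.2 (by rw [map_mul, map_inv, hgh, mul_inv_cancel])⟩, by
    change (g * h⁻¹) • (h • D) = g • D
    rw [smul_smul, inv_mul_cancel_right]⟩

theorem quotA_smul_eq {g h : GLPoly (ZMod 2)} (hgh : redG a b g = redG a b h)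
    (E : (tree (ZMod 2)).A) : quotA a b (g • E) = quotA a b (h • E) :=
  Quotient.sound ⟨⟨g * h⁻¹, mem_Gam_iff.2 (by rw [map_mul, map_inv, hgh, mul_inv_cancel])⟩, by
    change (g * h⁻¹) • (h • E) = g • E
    rw [smul_smul, inv_mul_cancel_right]⟩

/-- If γ in Γ(f) takes hE to gD, then g⁻¹γh takes E to D and reduces to g⁻¹h. For D = E, equality in
the quotient becomes membership of g⁻¹h in the reduced stabilizer. -/
theorem exists_of_quotV_eq {g h : GLPoly (ZMod 2)} {D E : (tree (ZMod 2)).V}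
    (H : quotV a b (g • D) = quotV a b (h • E)) :
    ∃ q, redG a b q = redG a b (g⁻¹ * h) ∧ q • E = D := by
  obtain ⟨⟨γ, hγ⟩, h1⟩ := Quotient.exact H
  have h2 : γ • (h • E) = g • D := h1
  refine ⟨g⁻¹ * γ * h, ?_, ?_⟩
  · rw [map_mul, map_mul, map_mul, mem_Gam_iff.1 hγ, mul_one]
  · rw [mul_smul, mul_smul, h2, inv_smul_smul]

theorem exists_of_quotA_eq {g h : GLPoly (ZMod 2)} {D E : (tree (ZMod 2)).A}
    (H : quotA a b (g • D) = quotA a b (h • E)) :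
    ∃ q, redG a b q = redG a b (g⁻¹ * h) ∧ q • E = D := by
  obtain ⟨⟨γ, hγ⟩, h1⟩ := Quotient.exact H
  have h2 : γ • (h • E) = g • D := h1
  refine ⟨g⁻¹ * γ * h, ?_, ?_⟩
  · rw [map_mul, map_mul, map_mul, mem_Gam_iff.1 hγ, mul_one]
  · rw [mul_smul, mul_smul, h2, inv_smul_smul]

theorem quotV_smul_vertexZero_eq_iff {g h : GLPoly (ZMod 2)} :
    quotV a b (g • vertexZero (ZMod 2)) = quotV a b (h • vertexZero (ZMod 2)) ↔
      ∃ k, redG a b (g⁻¹ * h) = constQ a b k := by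
  constructor
  · intro H
    obtain ⟨q, hq, hq'⟩ := exists_of_quotV_eq H
    obtain ⟨k, rfl⟩ := exists_eq_constEmb hq'
    exact ⟨k, by rw [← hq, redG_constEmb]⟩
  · rintro ⟨k, hk⟩
    rw [← redG_constEmb, map_mul, map_inv, inv_mul_eq_iff_eq_mul, ← map_mul] at hk
    rw [quotV_smul_eq hk, mul_smul, constEmb_smul_vertexZero]

theorem exists_of_quotV_smul_vertexOne_eq {g h : GLPoly (ZMod 2)}
    (H : quotV a b (g • vertexOne (ZMod 2)) = quotV a b (h • vertexOne (ZMod 2))) :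
    ∃ x y, redG a b h = redG a b (g * unip x y) := by
  obtain ⟨q, hq, hq'⟩ := exists_of_quotV_eq H
  obtain ⟨x, y, rfl⟩ := exists_eq_unip hq'
  refine ⟨x, y, ?_⟩
  rw [map_mul, hq, map_mul, map_inv, mul_inv_cancel_left]

/-- The first edge of the standard ray. -/
noncomputable def firstEdge : (tree (ZMod 2)).A :=
  ⟨(vertexZero (ZMod 2), vertexOne (ZMod 2)), neighbors_vertexZero_vertexOne⟩

theorem unip_zero_smul_firstEdge (x : ZMod 2) : unip x 0 • firstEdge = firstEdge := by
  apply Subtype.ext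
  refine Prod.ext ?_ (unip_smul_vertexOne x 0)
  change unip x 0 • vertexZero (ZMod 2) = vertexZero (ZMod 2)
  rw [unip_zero_right, constEmb_smul_vertexZero]

/-- The matrix `[[1, t], [0, 1]]`. -/
noncomputable abbrev unipT : GLPoly (ZMod 2) := unip 0 1

theorem redG_unipT : redG a b unipT = unipOmega := redG_unip 0 1

theorem unipOmega_ne_constQ (k : GL (Fin 2) (ZMod 2)) : unipOmega ≠ constQ a b k := by
  intro h
  have h1 := congrArg (fun M => imM M.1 0 1) h
  simp only [imM_unipOmega, imM_constQ] at h1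
  exact absurd h1 (by simp)

/-- Otherwise some element fixing the type-0 end, hence constant, would reduce to `unipOmega`, which
has a nonzero imaginary part. -/
theorem quotA_unipT_ne (g : GLPoly (ZMod 2)) :
    quotA a b (g • firstEdge) ≠ quotA a b ((g * unipT) • firstEdge) := by
  intro H
  obtain ⟨q, hq, hq'⟩ := exists_of_quotA_eq H
  obtain ⟨k, rfl⟩ := exists_eq_constEmb (congrArg (tree (ZMod 2)).s hq')
  rw [inv_mul_cancel_left, redG_unipT, redG_constEmb] at hq
  exact unipOmega_ne_constQ k hq.symm

theorem exists_eq_smul_firstEdge {E : (tree (ZMod 2)).A} {g : GLPoly (ZMod 2)}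
    (h : (tree (ZMod 2)).s E = g • vertexZero (ZMod 2)) :
    ∃ k, E = (g * constEmb k) • firstEdge := by
  have hN : Neighbors (vertexZero (ZMod 2)).1 (g⁻¹ • (tree (ZMod 2)).t E).1 := by
    have h1 := Neighbors.conj E.2 (glEmb g⁻¹)
    have h2 : conj (glEmb g⁻¹) E.1.1.1 = (vertexZero (ZMod 2)).1 := by
      change (g⁻¹ • (tree (ZMod 2)).s E).1 = _
      rw [h, inv_smul_smul]
    rw [h2] at h1
    exact h1
  obtain ⟨k, hk⟩ := hN.exists_eq_constEmb_smul
  refine ⟨k, Subtype.ext (Prod.ext ?_ ?_)⟩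
  · change (tree (ZMod 2)).s E = (g * constEmb k) • vertexZero (ZMod 2)
    rw [mul_smul, constEmb_smul_vertexZero, h]
  · change (tree (ZMod 2)).t E = (g * constEmb k) • vertexOne (ZMod 2)
    rw [mul_smul, ← hk, smul_inv_smul]

theorem exists_quotA_eq_of_isType_zero {e : (quotGraph (quadPoly a b)).A}
    (h : IsType (quadPoly a b) 0 ((quotGraph (quadPoly a b)).s e)) :
    ∃ g : GLPoly (ZMod 2), e = quotA a b (g • firstEdge) := by
  induction e using Quotient.inductionOn with
  | _ E =>
    obtain ⟨g, hg⟩ := h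
    obtain ⟨⟨γ, hγ⟩, h1⟩ := Quotient.exact hg
    have h2 : γ • (g • vertexZero (ZMod 2)) = (tree (ZMod 2)).s E := h1
    rw [smul_smul] at h2
    obtain ⟨k, hk⟩ := exists_eq_smul_firstEdge h2.symm
    exact ⟨γ * g * constEmb k, congrArg (quotA a b) hk⟩

theorem isType_zero_quotV (g : GLPoly (ZMod 2)) :
    IsType (quadPoly a b) 0 (quotV a b (g • vertexZero (ZMod 2))) := ⟨g, rfl⟩

theorem isType_one_quotV (g : GLPoly (ZMod 2)) :
    IsType (quadPoly a b) 1 (quotV a b (g • vertexOne (ZMod 2))) := ⟨g, rfl⟩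

theorem not_isType_zero_quotV (g : GLPoly (ZMod 2)) :
    ¬ IsType (quadPoly a b) 0 (quotV a b (g • vertexOne (ZMod 2))) := by
  rintro ⟨h, hh⟩
  obtain ⟨⟨γ, hγ⟩, h1⟩ := Quotient.exact hh
  have h2 : γ • (h • vertexZero (ZMod 2)) = g • vertexOne (ZMod 2) := h1
  rw [smul_smul] at h2
  exact smul_vertexZero_ne _ _ h2

theorem not_isType_one_of_isType_one {e : (quotGraph (quadPoly a b)).A}
    (hs : IsType (quadPoly a b) 1 ((quotGraph (quadPoly a b)).s e)) :
    ¬ IsType (quadPoly a b) 1 ((quotGraph (quadPoly a b)).t e) := by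
  induction e using Quotient.inductionOn with
  | _ E =>
    rintro ⟨h, hh⟩
    obtain ⟨g, hg⟩ := hs
    obtain ⟨⟨γ, hγ⟩, h1⟩ := Quotient.exact hg
    obtain ⟨⟨δ, hδ⟩, h2⟩ := Quotient.exact hh
    have h3 : γ • (g • vertexOne (ZMod 2)) = (tree (ZMod 2)).s E := h1
    have h4 : δ • (h • vertexOne (ZMod 2)) = (tree (ZMod 2)).t E := h2
    have hN : Neighbors ((tree (ZMod 2)).s E).1 ((tree (ZMod 2)).t E).1 := E.2
    rw [← h3, ← h4, smul_smul, smul_smul] at hN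
    exact not_neighbors_vertexOne _ _ hN

/-! ### The graph of vertices of type zero and one -/

/-- All neighbors of a type-0 vertex have type 1, and two type-1 vertices are never adjacent, having
the same colour. -/
theorem typeZero_s_iff (e : (graphA (quadPoly a b)).A) :
    TypeZero (quadPoly a b) ((graphA (quadPoly a b)).s e) ↔
      ¬ TypeZero (quadPoly a b) ((graphA (quadPoly a b)).t e) := by
  obtain ⟨e, hs, ht⟩ := e
  change IsType (quadPoly a b) 0 ((quotGraph (quadPoly a b)).s e) ↔
    ¬ IsType (quadPoly a b) 0 ((quotGraph (quadPoly a b)).t e)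
  constructor
  · intro h
    obtain ⟨g, rfl⟩ := exists_quotA_eq_of_isType_zero h
    exact not_isType_zero_quotV g
  · intro h
    by_contra h'
    exact not_isType_one_of_isType_one (hs.resolve_left h') (ht.resolve_left h)

/-- The image of a translate of the first edge. -/
noncomputable def edgeA (g : GLPoly (ZMod 2)) : (graphA (quadPoly a b)).A :=
  ⟨quotA a b (g • firstEdge), Or.inl (isType_zero_quotV g), Or.inr (isType_one_quotV g)⟩

theorem exists_eq_edgeA {e : (graphA (quadPoly a b)).A}
    (h : TypeZero (quadPoly a b) ((graphA (quadPoly a b)).s e)) : ∃ g, e = edgeA g := by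
  obtain ⟨g, hg⟩ := exists_quotA_eq_of_isType_zero h
  exact ⟨g, Subtype.ext hg⟩

theorem edgeA_eq {g h : GLPoly (ZMod 2)} (H : redG a b g = redG a b h) :
    edgeA (a := a) (b := b) g = edgeA h := Subtype.ext (quotA_smul_eq H firstEdge)

theorem edgeA_mul_unip_zero (g : GLPoly (ZMod 2)) (x : ZMod 2) :
    edgeA (a := a) (b := b) (g * unip x 0) = edgeA g := by
  apply Subtype.ext
  change quotA a b _ = quotA a b _
  rw [mul_smul, unip_zero_smul_firstEdge]

theorem edgeA_unipT_ne (g : GLPoly (ZMod 2)) :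
    edgeA (a := a) (b := b) g ≠ edgeA (g * unipT) := fun h =>
  quotA_unipT_ne g (congrArg Subtype.val h)

theorem t_edgeA_unipT (g : GLPoly (ZMod 2)) : (graphA (quadPoly a b)).t (edgeA (g * unipT)) =
    (graphA (quadPoly a b)).t (edgeA g) := by
  apply Subtype.ext
  change quotV a b ((g * unipT) • vertexOne (ZMod 2)) = quotV a b (g • vertexOne (ZMod 2))
  rw [mul_smul, unip_smul_vertexOne]

/-- The edges ending at a given vertex of type one. -/
theorem eq_or_eq_of_t_edgeA_eq {g h : GLPoly (ZMod 2)}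
    (H : (graphA (quadPoly a b)).t (edgeA h) = (graphA (quadPoly a b)).t (edgeA g)) :
    edgeA (a := a) (b := b) h = edgeA g ∨ edgeA (a := a) (b := b) h = edgeA (g * unipT) := by
  have H' : quotV a b (h • vertexOne (ZMod 2)) = quotV a b (g • vertexOne (ZMod 2)) :=
    congrArg Subtype.val H
  obtain ⟨x, y, hxy⟩ := exists_of_quotV_smul_vertexOne_eq H'.symm
  -- The factor `unip x 0` fixes the first edge, so only y counts, and it has two values.
  have e : g * unip x y = g * unip 0 y * unip x 0 := by rw [mul_assoc, unip_mul, zero_add, add_zero]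
  rw [edgeA_eq hxy, e, edgeA_mul_unip_zero]
  have hy : ∀ y : ZMod 2, y = 0 ∨ y = 1 := by decide
  rcases hy y with rfl | rfl
  · exact Or.inl (edgeA_mul_unip_zero g 0)
  · exact Or.inr rfl

theorem exists_two_edges {x : (graphA (quadPoly a b)).V} (hx : ¬ TypeZero (quadPoly a b) x) :
    ∃ e₁ e₂, e₁ ≠ e₂ ∧ (graphA (quadPoly a b)).s e₁ = x ∧ (graphA (quadPoly a b)).s e₂ = x ∧
      ∀ e, (graphA (quadPoly a b)).s e = x → e = e₁ ∨ e = e₂ := by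
  obtain ⟨g, hg⟩ := x.2.resolve_left hx
  have hg' : (graphA (quadPoly a b)).t (edgeA g) = x := Subtype.ext hg.symm
  refine ⟨(graphA (quadPoly a b)).r (edgeA g), (graphA (quadPoly a b)).r (edgeA (g * unipT)),
    fun h => edgeA_unipT_ne (a := a) (b := b) g ?_, ?_, ?_, ?_⟩
  · rw [← (graphA (quadPoly a b)).r_r (edgeA g), h, (graphA (quadPoly a b)).r_r]
  · rw [(graphA (quadPoly a b)).s_r, hg']
  · rw [(graphA (quadPoly a b)).s_r, t_edgeA_unipT, hg']
  · intro e he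
    obtain ⟨h, hh⟩ : ∃ h, (graphA (quadPoly a b)).r e = edgeA h := by
      apply exists_eq_edgeA
      rw [typeZero_s_iff, (graphA (quadPoly a b)).t_r, he]
      exact hx
    have he' : e = (graphA (quadPoly a b)).r (edgeA h) := by
      rw [← hh, (graphA (quadPoly a b)).r_r]
    rw [he', (graphA (quadPoly a b)).s_r, ← hg'] at he
    rw [he']
    exact (eq_or_eq_of_t_edgeA_eq he).imp (congrArg _) (congrArg _)

/-! ### The graph of vertices of type zero -/

/-- The image of a translate of the first vertex. -/
noncomputable def vertexO (g : GLPoly (ZMod 2)) : (graphO (quadPoly a b)).V :=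
  ⟨(graphA (quadPoly a b)).s (edgeA g), isType_zero_quotV g⟩

theorem exists_eq_vertexO (v : (graphO (quadPoly a b)).V) : ∃ g, v = vertexO g := by
  obtain ⟨g, hg⟩ := v.2
  exact ⟨g, Subtype.ext (Subtype.ext hg)⟩

theorem vertexO_eq_iff {g h : GLPoly (ZMod 2)} :
    vertexO (a := a) (b := b) g = vertexO h ↔ ∃ k, redG a b (g⁻¹ * h) = constQ a b k := by
  rw [← quotV_smul_vertexZero_eq_iff]
  exact ⟨fun h => congrArg (fun v => v.1.1) h, fun h => Subtype.ext (Subtype.ext h)⟩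

theorem vertexO_mul_constEmb (g : GLPoly (ZMod 2)) (k : GL (Fin 2) (ZMod 2)) :
    vertexO (a := a) (b := b) (g * constEmb k) = vertexO g := by
  rw [eq_comm, vertexO_eq_iff, inv_mul_cancel_left]
  exact ⟨k, redG_constEmb k⟩

theorem vertexO_eq {g h : GLPoly (ZMod 2)} (H : redG a b g = redG a b h) :
    vertexO (a := a) (b := b) g = vertexO h := by
  rw [vertexO_eq_iff, map_mul, map_inv, H, inv_mul_cancel]
  exact ⟨1, (map_one _).symm⟩

/-- The edges of the graph of vertices of type zero. -/
theorem exists_eq_of_graphO_A (p : (graphO (quadPoly a b)).A) :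
    ∃ g, p.1 = (edgeA g, (graphA (quadPoly a b)).r (edgeA (g * unipT))) := by
  obtain ⟨⟨e₁, e₂⟩, h1, h2, h3, h4, h5⟩ := p
  obtain ⟨g, rfl⟩ := exists_eq_edgeA h3
  dsimp only at h1 h2 h3 h4 h5
  obtain ⟨h, hh⟩ : ∃ h, (graphA (quadPoly a b)).r e₂ = edgeA h := by
    apply exists_eq_edgeA
    rwa [(graphA (quadPoly a b)).s_r]
  have he : e₂ = (graphA (quadPoly a b)).r (edgeA h) := by
    rw [← hh, (graphA (quadPoly a b)).r_r]
  subst he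
  rw [(graphA (quadPoly a b)).s_r] at h1
  refine ⟨g, Prod.ext rfl ?_⟩
  rcases eq_or_eq_of_t_edgeA_eq h1.symm with h | h
  · exact absurd (congrArg (graphA (quadPoly a b)).r h) h2
  · exact congrArg (graphA (quadPoly a b)).r h

theorem exists_graphO_A (g : GLPoly (ZMod 2)) : ∃ p : (graphO (quadPoly a b)).A,
    (graphO (quadPoly a b)).s p = vertexO g ∧
      (graphO (quadPoly a b)).t p = vertexO (g * unipT) := by
  refine ⟨⟨(edgeA g, (graphA (quadPoly a b)).r (edgeA (g * unipT))), ?_, ?_, ?_, ?_, ?_⟩, ?_, ?_⟩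
  · rw [(graphA (quadPoly a b)).s_r, t_edgeA_unipT]
  · intro h
    apply edgeA_unipT_ne (a := a) (b := b) g
    rw [← (graphA (quadPoly a b)).r_r (edgeA g), ← h, (graphA (quadPoly a b)).r_r]
  · exact isType_zero_quotV g
  · exact not_isType_zero_quotV g
  · rw [(graphA (quadPoly a b)).t_r]
    exact isType_zero_quotV _
  · rfl
  · exact Subtype.ext ((graphA (quadPoly a b)).t_r _)

theorem exists_eq_vertexO_of_graphO_A (p : (graphO (quadPoly a b)).A) :
    ∃ g, p.1 = (edgeA g, (graphA (quadPoly a b)).r (edgeA (g * unipT))) ∧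
      (graphO (quadPoly a b)).s p = vertexO g ∧
      (graphO (quadPoly a b)).t p = vertexO (g * unipT) := by
  obtain ⟨g, hg⟩ := exists_eq_of_graphO_A p
  refine ⟨g, hg, Subtype.ext ?_, Subtype.ext ?_⟩
  · change (graphA (quadPoly a b)).s p.1.1 = _
    rw [hg]
    rfl
  · change (graphA (quadPoly a b)).t p.1.2 = _
    rw [hg, (graphA (quadPoly a b)).t_r]
    rfl

/-- If the edges from g to gu and from h to hu have the same ends, then g⁻¹h reduces into K ∩ uKu⁻¹,
so to some `unip x 0`. This commutes with `unipT` and fixes the first edge, so both halves of the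
two paths agree. -/
theorem graphO_A_ext {p q : (graphO (quadPoly a b)).A}
    (hs : (graphO (quadPoly a b)).s p = (graphO (quadPoly a b)).s q)
    (ht : (graphO (quadPoly a b)).t p = (graphO (quadPoly a b)).t q) : p = q := by
  obtain ⟨g, hp, hps, hpt⟩ := exists_eq_vertexO_of_graphO_A p
  obtain ⟨h, hq, hqs, hqt⟩ := exists_eq_vertexO_of_graphO_A q
  rw [hps, hqs, vertexO_eq_iff] at hs
  rw [hpt, hqt, vertexO_eq_iff] at ht
  obtain ⟨k, hk⟩ := hs
  obtain ⟨k', hk'⟩ := ht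
  have e : (g * unipT)⁻¹ * (h * unipT) = unipT⁻¹ * (g⁻¹ * h) * unipT := by group
  rw [e, map_mul, map_mul, map_inv, hk, redG_unipT, mul_assoc, inv_mul_eq_iff_eq_mul] at hk'
  obtain ⟨x, rfl⟩ := exists_eq_upperRightHom_of_unipOmega_conj hk'
  rw [← redG_constEmb, ← unip_zero_right, map_mul, map_inv, inv_mul_eq_iff_eq_mul, ← map_mul] at hk
  have hk2 : redG a b (h * unipT) = redG a b (g * unipT * unip x 0) := by
    rw [map_mul, hk, ← map_mul, mul_assoc, mul_assoc, unip_mul, unip_mul, add_comm x, add_comm 1]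
  apply Subtype.ext
  rw [hp, hq, edgeA_eq hk, edgeA_eq hk2, edgeA_mul_unip_zero, edgeA_mul_unip_zero]

/-- The identification of the graph of vertices of type zero with a simple graph, from
representatives of its vertices. -/
theorem nonempty_graphO_iso {W : Type} {G : SimpleGraph W}
    (τ : W → Matrix (Fin 2) (Fin 2) (QuadraticAlgebra (ZMod 2) a b)) (hdet : ∀ w, (τ w).det = 1)
    (hsurj : ∀ M : Matrix (Fin 2) (Fin 2) (QuadraticAlgebra (ZMod 2) a b), M.det = 1 →
      ∃ w, imM ((τ w).adjugate * M) = 0)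
    (hinj : ∀ w w', imM ((τ w).adjugate * τ w') = 0 → w = w')
    (hadj : ∀ w w', G.Adj w w' ↔ w ≠ w' ∧ (imM ((τ w).adjugate * τ w')).det = 0) :
    Nonempty ((graphO (quadPoly a b)).Iso (SerreGraph.ofSimpleGraph G)) := by
  choose γ hγ using fun w => exists_redG_eq (hdet w)
  have hinv : ∀ w h, (redG a b ((γ w)⁻¹ * h)).1 = (τ w).adjugate * (redG a b h).1 := by
    intro w h
    rw [map_mul, map_inv, Units.val_mul]
    congr 1
    apply Units.inv_eq_of_mul_eq_one_right
    rw [hγ, Matrix.mul_adjugate, hdet, one_smul]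
  have hΦ : Function.Bijective fun w => vertexO (a := a) (b := b) (γ w) := by
    constructor
    · intro w w' h
      obtain ⟨k, hk⟩ := vertexO_eq_iff.1 h
      apply hinj
      rw [← hγ w', ← hinv, hk, imM_constQ]
    · intro v
      obtain ⟨g, rfl⟩ := exists_eq_vertexO v
      obtain ⟨w, hw⟩ := hsurj _ (det_redG g)
      rw [← hinv] at hw
      exact ⟨w, vertexO_eq_iff.2 (exists_constQ_eq hw)⟩
  set Φ := Equiv.ofBijective _ hΦ with hΦd
  have hΦa : ∀ w, Φ w = vertexO (γ w) := fun _ => rfl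
  refine SerreGraph.nonempty_iso_ofSimpleGraph Φ.symm Φ.symm.bijective ?_
    (fun _ _ => graphO_A_ext) ?_
  · intro p
    obtain ⟨g, -, hs, ht⟩ := exists_eq_vertexO_of_graphO_A p
    obtain ⟨w, hw⟩ := Φ.surjective ((graphO (quadPoly a b)).s p)
    obtain ⟨w', hw'⟩ := Φ.surjective ((graphO (quadPoly a b)).t p)
    rw [← hw, ← hw', Equiv.symm_apply_apply, Equiv.symm_apply_apply]
    rw [hs, hΦa, vertexO_eq_iff] at hw
    rw [ht, hΦa, eq_comm, vertexO_eq_iff] at hw'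
    obtain ⟨k, hk⟩ := hw
    obtain ⟨k', hk'⟩ := hw'
    have e : (γ w)⁻¹ * γ w' = (γ w)⁻¹ * g * unipT * ((g * unipT)⁻¹ * γ w') := by group
    have hQ : (τ w).adjugate * τ w' = (constQ a b k).1 * unipOmega.1 * (constQ a b k').1 := by
      rw [← hγ w', ← hinv, e, map_mul, map_mul, hk, hk', redG_unipT, Units.val_mul, Units.val_mul]
    rw [hadj, hQ, imM_constQ_mul_mul, imM_unipOmega]
    constructor
    -- A loop would put the identity into KuK, although its imaginary part is zero and that of u is
    -- not.
    · rintro rfl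
      rw [Matrix.adjugate_mul, hdet, one_smul] at hQ
      have h1 := congrArg imM hQ
      rw [imM_constQ_mul_mul, imM_unipOmega, ← Units.val_one, ← map_one (constQ a b),
        imM_constQ] at h1
      have h2 : k⁻¹.1 * (k.1 * !![0, 1; 0, 0] * k'.1) * k'⁻¹.1 = !![0, 1; 0, 0] := by
        rw [mul_assoc k.1, Units.inv_mul_cancel_left, Units.mul_inv_cancel_right]
      rw [← h1, mul_zero, zero_mul] at h2
      exact absurd (congrFun (congrFun h2 0) 1) (by simp)
    · rw [Matrix.det_mul, Matrix.det_mul]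
      simp
  · intro x y hxy
    obtain ⟨w, rfl⟩ := Φ.surjective x
    obtain ⟨w', rfl⟩ := Φ.surjective y
    rw [Equiv.symm_apply_apply, Equiv.symm_apply_apply, hadj, ← hγ w', ← hinv] at hxy
    -- A nonzero singular imaginary part means g⁻¹h = kuk', so the edge from gk to gku joins gK to
    -- hK.
    obtain ⟨k, k', hk⟩ := exists_eq_constQ_mul_unipOmega_mul (det_redG _) (fun h => hxy.1
      (hinj w w' (by rw [← hγ w', ← hinv, h]))) hxy.2
    obtain ⟨p, hs, ht⟩ := exists_graphO_A (a := a) (b := b) (γ w * constEmb k)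
    refine ⟨p, by rw [hs, vertexO_mul_constEmb, hΦa], ?_⟩
    rw [ht, hΦa, ← vertexO_mul_constEmb _ k']
    apply vertexO_eq
    rw [map_mul, map_inv, inv_mul_eq_iff_eq_mul] at hk
    rw [hk]
    simp only [map_mul, redG_constEmb, redG_unipT, mul_assoc]

end InfTree

namespace InfTree

open Matrix QuadraticAlgebra

/-! ### Representatives of the vertices -/

/-- Representatives of the cosets of `SL₂(𝔽₂)` in `SL₂(𝔽₂ × 𝔽₂)`, where `𝔽₂ × 𝔽₂ = 𝔽₂[ω]` with
`ω² = ω`: the matrices that are the identity at the first factor. The two parts are the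
rotations and the reflections at the second factor. -/
def reprK33 (w : Fin 3 ⊕ Fin 3) : Matrix (Fin 2) (Fin 2) (QuadraticAlgebra (ZMod 2) 0 1) :=
  let ρ : Matrix (Fin 2) (Fin 2) (ZMod 2) := !![0, 1; 1, 1]
  let σ : Matrix (Fin 2) (Fin 2) (ZMod 2) := w.elim (fun i : Fin 3 => ρ ^ (i : ℕ))
    (fun i : Fin 3 => ρ ^ (i : ℕ) * !![0, 1; 1, 0])
  Matrix.of fun i j => ⟨(1 : Matrix (Fin 2) (Fin 2) (ZMod 2)) i j,
    (1 : Matrix (Fin 2) (Fin 2) (ZMod 2)) i j + σ i j⟩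

/-- Representatives of the cosets of `SL₂(𝔽₂)` in `SL₂(𝔽₂[ε])`, where `ε = ω + c` has square zero:
the matrices `1 + ε A` with `A` of trace zero. -/
def reprCube (c : ZMod 2) (x : Fin 3 → Fin 2) :
    Matrix (Fin 2) (Fin 2) (QuadraticAlgebra (ZMod 2) c 0) :=
  let y : Fin 3 → ZMod 2 := x
  1 + (⟨c, 1⟩ : QuadraticAlgebra (ZMod 2) c 0) •
    -- The coordinates refer to the basis of the trace-zero matrices formed by E₀₁, E₁₀ and the
    -- all-ones matrix, which are the nonzero nilpotent ones.
    (!![y 2, y 0 + y 2; y 1 + y 2, y 2] : Matrix (Fin 2) (Fin 2) (ZMod 2)).map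
      (algebraMap (ZMod 2) (QuadraticAlgebra (ZMod 2) c 0))

/-- The points of the projective line over the field `𝔽₄ = 𝔽₂[ω]` with `ω² = ω + 1`. -/
def projPoint (i : Fin 5) : Fin 2 → QuadraticAlgebra (ZMod 2) 1 1 :=
  ![![0, 1], ![1, 1], ![⟨0, 1⟩, 1], ![⟨1, 1⟩, 1], ![1, 0]] i

/-- Representatives of the cosets of `SL₂(𝔽₂)`, the stabilizer of `{ω, ω²}`, in `SL₂(𝔽₄)`: matrices
taking `{ω, ω²}` to a given pair of points of the projective line. -/
def reprPetersen (S : {S : Finset (Fin 5) // S.card = 2}) :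
    Matrix (Fin 2) (Fin 2) (QuadraticAlgebra (ZMod 2) 1 1) :=
  let h : S.1.Nonempty := Finset.card_pos.1 (by rw [S.2]; exact Nat.two_pos)
  let p := projPoint (S.1.min' h)
  let q := projPoint (S.1.max' h)
  -- The determinant of the first factor below is δ³ = 1, as δ is a unit of F₄. The second has
  -- determinant ω - ω² = 1 and takes the points ω, ω² to the two coordinate points, which the first
  -- takes to p, q.
  let δ := p 0 * q 1 - p 1 * q 0
  !![δ * δ * p 0, q 0; δ * δ * p 1, q 1] * !![1, ⟨1, 1⟩; 1, ⟨0, 1⟩]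

/-- Here SL₂(R) is S₃ × S₃ and K is diagonal. For second components σ, σ' the imaginary part is 1 +
σ⁻¹σ', which is singular exactly when σ⁻¹σ' is the identity or a transposition; so adjacency means
opposite signs. -/
theorem nonempty_iso_graphK33 :
    Nonempty ((graphO (quadPoly 0 1)).Iso (SerreGraph.ofSimpleGraph graphK33)) := by
  refine nonempty_graphO_iso reprK33 (by decide +kernel) (by decide +kernel) (by decide +kernel) ?_
  change ∀ w w' : Fin 3 ⊕ Fin 3, (w.isLeft ∧ w'.isRight ∨ w.isRight ∧ w'.isLeft) ↔ _
  decide +kernel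

/-- As (1 + εA)⁻¹(1 + εA') = 1 + ε(A + A'), adjacency means that A + A' is nonzero of trace and
determinant zero, hence one of the three basis elements. This is the Cayley graph of F₂³ for a
basis. -/
theorem nonempty_iso_cubeGraph (c : ZMod 2) :
    Nonempty ((graphO (quadPoly c 0)).Iso (SerreGraph.ofSimpleGraph cubeGraph)) := by
  refine nonempty_graphO_iso (reprCube c) ?_ ?_ ?_ ?_
  · revert c; decide +kernel
  · revert c; decide +kernel
  · revert c; decide +kernel
  · revert c
    change ∀ (c : ZMod 2) (w w' : Fin 3 → Fin 2), hammingDist w w' = 1 ↔ _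
    decide +kernel

/-- The group SL₂(F₄) permutes the five points of the projective line, and K is the stabilizer of
{ω, ω²}. The matrix u takes this pair to the disjoint pair {0, 1}, and K permutes transitively the
three pairs disjoint from {ω, ω²}. -/
theorem nonempty_iso_petersenGraph :
    Nonempty ((graphO (quadPoly 1 1)).Iso (SerreGraph.ofSimpleGraph petersenGraph)) := by
  refine nonempty_graphO_iso reprPetersen (by decide +kernel) (by decide +kernel)
    (by decide +kernel) ?_
  change ∀ S T : {S : Finset (Fin 5) // S.card = 2}, Disjoint S.1 T.1 ↔ _
  decide +kernel

/-! ### Quadratic polynomials over F₂, and the theorem. -/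

theorem eq_quadPoly {f : Polynomial (ZMod 2)} (hf : f.natDegree = 2) :
    f = quadPoly (f.coeff 0) (f.coeff 1) := by
  have h2 : f.coeff 2 = 1 := by
    have h0 : f.leadingCoeff ≠ 0 := by
      rw [Polynomial.leadingCoeff_ne_zero]
      rintro rfl
      simp at hf
    rw [Polynomial.leadingCoeff, hf] at h0
    have : ∀ c : ZMod 2, c ≠ 0 → c = 1 := by decide
    exact this _ h0
  conv_lhs => rw [Polynomial.as_sum_range' f 3 (by omega)]
  simp only [Finset.sum_range_succ, Finset.sum_range_zero, h2, quadPoly,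
    ← Polynomial.C_mul_X_pow_eq_monomial, map_one]
  ring

end InfTree

theorem theoremt12 (f : Polynomial (ZMod 2)) (hf : f.natDegree = 2) :
    (∃ φ : (InfTree.graphA f).Iso (InfTree.graphO f).subdivision,
      ∀ x : (InfTree.graphA f).V,
        InfTree.TypeZero f x ↔ ∃ v : (InfTree.graphO f).V, φ.onV x = Sum.inl v) ∧
    (f = Polynomial.X * (Polynomial.X + 1) →
      Nonempty ((InfTree.graphO f).Iso (SerreGraph.ofSimpleGraph graphK33))) ∧
    (IsSquare f →
      Nonempty ((InfTree.graphO f).Iso (SerreGraph.ofSimpleGraph cubeGraph))) ∧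
    (f = Polynomial.X ^ 2 + Polynomial.X + 1 →
      Nonempty ((InfTree.graphO f).Iso (SerreGraph.ofSimpleGraph petersenGraph))) := by
  refine ⟨?_, ?_, ?_, ?_⟩
  · rw [InfTree.eq_quadPoly hf]
    exact SerreGraph.exists_iso_subdivision InfTree.typeZero_s_iff
      fun _ hx => InfTree.exists_two_edges hx
  · intro h
    have e : f = InfTree.quadPoly 0 1 := by
      rw [h, InfTree.quadPoly, map_one, map_zero]
      ring
    rw [e]
    exact InfTree.nonempty_iso_graphK33
  · rintro ⟨g, hg⟩
    -- The linear coefficient of a square is twice a product, so f = t² + c.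
    have h1 : f.coeff 1 = 0 := by
      have h2 : ∀ x y : ZMod 2, x * y + y * x = 0 := by decide
      rw [hg, Polynomial.coeff_mul, Finset.Nat.sum_antidiagonal_succ]
      simpa using h2 _ _
    rw [InfTree.eq_quadPoly hf, h1]
    exact InfTree.nonempty_iso_cubeGraph _
  · intro h
    have e : f = InfTree.quadPoly 1 1 := by
      rw [h, InfTree.quadPoly, map_one]
      ring
    rw [e]
    exact InfTree.nonempty_iso_petersenGraph
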